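/- Let $X_1,X_2,\dots$ be i.i.d. real random variables with distribution function $F$ and $E(X_1^2)<\infty$, and let $t_0\in(0,1)$. Put $\psi=\inf\{x:F(x)\ge t_0\}$, and assume that $F$ is continuous in a neighbourhood of $\psi$ and that $F(x)>t_0$ for all $x>\psi$ (for example, $F$ has a density that is positive near $\psi$). Let $$\theta=E[X_1 I(X_1\le\psi)],\qquad \sigma_p^2=\mathrm{Var}\big(X_1I(X_1\le\psi)\big),\qquad \sigma_v^2=\mathrm{Var}\big((X_1-\psi)I(X_1\le\psi)\big).$$ For $n\ge1$ let $F_n$ be the empirical distribution function of $X_1,\dots,X_n$, let $\widehat\psi=\inf\{x:F_n(x)\ge t_0\}$, and let $$\widehat W_i=X_iI(X_i\le\widehat\psi)-\theta\quad(1\le i\le n),\qquad \widehat W_{n+1}=-a_n\cdot\frac1n\sum_{i=1}^n\widehat W_i,\qquad a_n=\max\{1,\tfrac12\log n\}.$$ The adjusted empirical log-likelihood ratio at $\theta$ is $$\ell^*=-2\log\Big((n+1)^{n+1}\sup\Big\{\prod_{i=1}^{n+1}p_i:\ p_i\ge0,\ \sum_{i=1}^{n+1}p_i=1,\ \sum_{i=1}^{n+1}p_i\widehat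 W_i=0\Big\}\Big),$$ and the transformed adjusted empirical log-likelihood ratio is $$\ell_t^*=\ell^*\cdot\max\Big\{1-\frac{\ell^*}{n},\ \frac12\Big\}.$$ Then there is always a real $\lambda$ with $1+\lambda\widehat W_i>0$ for all $i\le n+1$ and $\sum_{i=1}^{n+1}\widehat W_i/(1+\lambda\widehat W_i)=0$, and for every such $\lambda$ one has $\ell^*=2\sum_{i=1}^{n+1}\log(1+\lambda\widehat W_i)$. Moreover $\sigma_p^2>0$, $\sigma_v^2>0$, and $$\frac{\sigma_p^2}{\sigma_v^2}\,\ell_t^*\longrightarrow\chi^2_1\quad\text{in distribution as } n\to\infty .$$ -/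

import Mathlib

open MeasureTheory ProbabilityTheory Filter Topology

noncomputable section

namespace Lorenz

/-- The left-continuous generalized inverse `inf {x : F x ≥ t}` of a distribution function `F`. -/
def quantile (F : ℝ → ℝ) (t : ℝ) : ℝ :=
  sInf {x : ℝ | t ≤ F x}

/-- The `t`-quantile `ψ_t` of the population law `ν`. -/
def popQuantile (ν : Measure ℝ) (t : ℝ) : ℝ :=
  quantile (fun x => cdf ν x) t

/-- The value at `x` of the truncated variable `X 1(X ≤ ψ)`. -/
def trunc (ψ x : ℝ) : ℝ :=
  (Set.Iic ψ).indicator (fun y => y) x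

/-- The generalized Lorenz ordinate `θ(t) = E[X 1(X ≤ ψ_t)]` of the law `ν`. -/
def lorenz (ν : Measure ℝ) (t : ℝ) : ℝ :=
  ∫ x, trunc (popQuantile ν t) x ∂ν

/-- `σ_p² = Var(X 1(X ≤ ψ_t))`. -/
def sigmaPSq (ν : Measure ℝ) (t : ℝ) : ℝ :=
  variance (fun x => trunc (popQuantile ν t) x) ν

/-- `σ_v² = Var((X - ψ_t) 1(X ≤ ψ_t))`. -/
def sigmaVSq (ν : Measure ℝ) (t : ℝ) : ℝ :=
  variance ((Set.Iic (popQuantile ν t)).indicator (fun x => x - popQuantile ν t)) ν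

/-- The empirical distribution function of a sample of size `n`. -/
def empCDF {n : ℕ} (x : Fin n → ℝ) (y : ℝ) : ℝ :=
  ((Finset.univ.filter (fun i => x i ≤ y)).card : ℝ) / n

/-- The estimated scores `Ŵ_i(t) = X_i 1(X_i ≤ ψ̂_t) - θ`, where `ψ̂_t` is the sample quantile. -/
def score {n : ℕ} (x : Fin n → ℝ) (t θ : ℝ) (i : Fin n) : ℝ :=
  trunc (quantile (empCDF x) t) (x i) - θ

/-- The adjustment level `a_n = max {1, (log n) / 2}`. -/
def adjLevel (n : ℕ) : ℝ :=
  max 1 (Real.log n / 2)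

/-- The scores `w_1, …, w_n` followed by the pseudo-value `w_{n+1} = -a_n (1/n) ∑ w_i`. -/
def adjoinPseudo {n : ℕ} (w : Fin n → ℝ) : Fin (n + 1) → ℝ :=
  Fin.snoc (α := fun _ => ℝ) w (-adjLevel n * ((1 / (n : ℝ)) * ∑ i, w i))

/-- The profile empirical likelihood
`sup {∏ p_i : p_i ≥ 0, ∑ p_i = 1, ∑ p_i w_i = 0}` of the scores `w_1, …, w_m`. -/
def empLik {m : ℕ} (w : Fin m → ℝ) : ℝ :=
  sSup {r : ℝ | ∃ p : Fin m → ℝ,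
    (∀ i, 0 ≤ p i) ∧ ∑ i, p i = 1 ∧ ∑ i, p i * w i = 0 ∧ r = ∏ i, p i}

/-- The empirical log-likelihood ratio `-2 log (m ^ m · sup ∏ p_i)`; the unconstrained maximum of
`∏ p_i` is `m ^ (-m)`. -/
def empLogLikRatio {m : ℕ} (w : Fin m → ℝ) : ℝ :=
  -2 * Real.log ((m : ℝ) ^ m * empLik w)

/-- `lam` solves the Lagrange equation `∑ w_i / (1 + lam w_i) = 0`, and the resulting weights
`1 / (m (1 + lam w_i))` are positive. -/
def IsMultiplier {m : ℕ} (w : Fin m → ℝ) (lam : ℝ) : Prop :=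
  (∀ i, 0 < 1 + lam * w i) ∧ ∑ i, w i / (1 + lam * w i) = 0

/-- The `n + 1` adjusted scores of the sample `x` at the candidate value `θ`. -/
def adjScore {n : ℕ} (x : Fin n → ℝ) (t θ : ℝ) : Fin (n + 1) → ℝ :=
  adjoinPseudo (score x t θ)

/-- The adjusted empirical log-likelihood ratio `ℓ*(θ)`. -/
def ael {n : ℕ} (x : Fin n → ℝ) (t θ : ℝ) : ℝ :=
  empLogLikRatio (adjScore x t θ)

/-- The transformed adjusted empirical log-likelihood ratio
`ℓ*_t(θ) = ℓ*(θ) · max {1 - ℓ*(θ) / n, 1 / 2}`. -/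
def tael {n : ℕ} (x : Fin n → ℝ) (t θ : ℝ) : ℝ :=
  ael x t θ * max (1 - ael x t θ / n) (1 / 2)

/-- The chi-square law with one degree of freedom: the law of `Z²` for `Z` standard normal. -/
def chiSqOne : Measure ℝ :=
  (gaussianReal 0 1).map (fun z => z ^ 2)

instance : IsProbabilityMeasure chiSqOne :=
  Measure.isProbabilityMeasure_map (by fun_prop)

end Lorenz

end

/-! Lagrange duality gives `ℓ* = 2 ∑ log (1 + λ w_i)`. With `A = ∑ w_i` and `B = ∑ w_i²`, the
multiplier equation forces `λ ≈ A / B`, and expanding the logarithm gives `ℓ* ≈ A² / B`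
(`IsMultiplier.abs_sub_le`). Put `T = n^(-1/2) ∑ Ŵ_i` over the original scores. The pseudo-value is
`-T (a_n / n) √n`, which is negligible because `a_n / n → 0`; the transforming factor tends to `1`.
The mean of `Ŵ_i²` tends to `σ_p²` almost surely, so `ℓ_t* ≈ T² / σ_p²`.

The numerator has a different variance, because the quantile is estimated. Split `X 1(X ≤ ψ̂) = (X -
ψ) 1(X ≤ ψ̂) + ψ 1(X ≤ ψ̂)`. The second part sums to `ψ n F_n(ψ̂)`, which is `ψ n t₀` up to a
bounded error. In the first part, moving `ψ̂` to `ψ` costs at most `|ψ̂ - ψ|` per observation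
crossed, hence `o(1) · O_P(√n)`. So `T` tends to `N(0, σ_v²)`, and the factor `σ_p² / σ_v²` corrects
the mismatch.

The estimates are deterministic, along a single sample path, restricted to the indices where a tight
statistic is at most `M`. `tendstoInMeasure_zero_of_tight` turns them into convergence in
probability, and Slutsky's theorem concludes. -/

namespace Lorenz

/-! ### Lagrange duality for the empirical likelihood -/

theorem prod_le_of_feasible {m : ℕ} {w : Fin m → ℝ} {lam : ℝ}
    (hpos : ∀ i, 0 < 1 + lam * w i) {p : Fin m → ℝ} (hp : ∀ i, 0 ≤ p i) (hp1 : ∑ i, p i = 1)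
    (hpw : ∑ i, p i * w i = 0) :
    ∏ i, p i ≤ ∏ i, (m * (1 + lam * w i))⁻¹ := by
  rcases Nat.eq_zero_or_pos m with rfl | hm
  · simp
  have hm' : (0 : ℝ) < m := by exact_mod_cast hm
  -- The ratios of `p i` to the candidate optimal weights have mean `1` by the two constraints, so
  -- AM-GM bounds their product by `1`.
  set z : Fin m → ℝ := fun i => p i * (m * (1 + lam * w i)) with hz
  have hz0 : ∀ i, 0 ≤ z i := fun i => mul_nonneg (hp i) (mul_pos hm' (hpos i)).le
  have hsum : ∑ i, z i = m := by
    have : ∀ i, z i = m * p i + m * lam * (p i * w i) := fun i => by simp only [hz]; ring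
    simp only [this, Finset.sum_add_distrib, ← Finset.mul_sum, hp1, hpw]
    ring
  have key := Real.geom_mean_le_arith_mean Finset.univ (fun _ => (1 : ℝ)) z (by simp)
    (by simpa using hm) (fun i _ => hz0 i)
  simp only [Real.rpow_one, one_mul, hsum, Finset.sum_const, Finset.card_univ, Fintype.card_fin,
    nsmul_eq_mul, mul_one, div_self hm'.ne'] at key
  have hle : ∏ i, z i ≤ 1 := by
    have h0 : 0 ≤ ∏ i, z i := Finset.prod_nonneg fun i _ => hz0 i
    by_contra! h
    exact absurd key (not_le.2 (Real.one_lt_rpow h (by positivity)))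
  have hsplit : ∏ i, p i = (∏ i, z i) * ∏ i, (m * (1 + lam * w i))⁻¹ := by
    rw [← Finset.prod_mul_distrib]
    refine Finset.prod_congr rfl fun i _ => ?_
    have := (mul_pos hm' (hpos i)).ne'
    simp only [hz]
    rw [mul_assoc, mul_inv_cancel₀ this, mul_one]
  rw [hsplit]
  refine mul_le_of_le_one_left (Finset.prod_nonneg fun i _ => ?_) hle
  exact inv_nonneg.2 (mul_pos hm' (hpos i)).le

theorem IsMultiplier.sum_inv {m : ℕ} {w : Fin m → ℝ} {lam : ℝ} (h : IsMultiplier w lam) :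
    ∑ i, (1 + lam * w i)⁻¹ = m := by
  have : ∀ i, (1 + lam * w i)⁻¹ = 1 - lam * (w i / (1 + lam * w i)) := fun i => by
    have := (h.1 i).ne'
    field_simp
    ring
  simp only [this, Finset.sum_sub_distrib, ← Finset.mul_sum, h.2]
  simp

theorem IsMultiplier.empLik_eq {m : ℕ} {w : Fin m → ℝ} {lam : ℝ} (hm : m ≠ 0)
    (h : IsMultiplier w lam) : empLik w = ∏ i, (m * (1 + lam * w i))⁻¹ := by
  have hm' : (0 : ℝ) < m := by exact_mod_cast Nat.pos_of_ne_zero hm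
  refine IsGreatest.csSup_eq ⟨⟨fun i => (m * (1 + lam * w i))⁻¹, ?_, ?_, ?_, rfl⟩, ?_⟩
  · exact fun i => inv_nonneg.2 (mul_pos hm' (h.1 i)).le
  · simp only [mul_inv, ← Finset.mul_sum, h.sum_inv]
    exact inv_mul_cancel₀ hm'.ne'
  · have : ∀ i, (m * (1 + lam * w i))⁻¹ * w i = (m : ℝ)⁻¹ * (w i / (1 + lam * w i)) := fun i => by
      rw [mul_inv, div_eq_mul_inv]; ring
    simp only [this, ← Finset.mul_sum, h.2, mul_zero]
  · rintro r ⟨p, hp, hp1, hpw, rfl⟩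
    exact prod_le_of_feasible h.1 hp hp1 hpw

theorem IsMultiplier.empLogLikRatio_eq {m : ℕ} {w : Fin m → ℝ} {lam : ℝ} (hm : m ≠ 0)
    (h : IsMultiplier w lam) : empLogLikRatio w = 2 * ∑ i, Real.log (1 + lam * w i) := by
  have hm' : (0 : ℝ) < m := by exact_mod_cast Nat.pos_of_ne_zero hm
  have : (m : ℝ) ^ m * ∏ i, (m * (1 + lam * w i))⁻¹ = ∏ i, (1 + lam * w i)⁻¹ := by
    simp only [mul_inv, Finset.prod_mul_distrib, Finset.prod_const, Finset.card_univ,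
      Fintype.card_fin, inv_pow]
    rw [mul_inv_cancel_left₀ (pow_pos hm' m).ne']
  rw [empLogLikRatio, h.empLik_eq hm, this, Real.log_prod fun i _ => inv_ne_zero (h.1 i).ne']
  simp only [Real.log_inv, Finset.sum_neg_distrib]
  ring

/-- A multiplier exists as soon as `0` is a positive combination of the scores. -/
theorem exists_isMultiplier {m : ℕ} (w q : Fin m → ℝ) (hq : ∀ i, 0 < q i)
    (hqw : ∑ i, q i * w i = 0) : ∃ lam, IsMultiplier w lam := by
  by_cases hw : ∀ i, w i = 0
  · exact ⟨0, by simp [IsMultiplier, hw]⟩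
  push Not at hw
  obtain ⟨i₀, hi₀⟩ := hw
  set K : Set ℝ := {lam | ∀ i, 0 ≤ 1 + lam * w i} with hK
  have hKclosed : IsClosed K := by
    simp only [hK, Set.ofPred_forall]
    exact isClosed_iInter fun i => isClosed_le (by fun_prop) (by fun_prop)
  -- The combination `∑ q i (1 + lam w i) = ∑ q i` does not depend on `lam`, so each nonnegative
  -- factor is bounded on `K`.
  have hKbdd : K ⊆ Metric.closedBall 0 ((1 + (∑ i, q i) / q i₀) / |w i₀|) := by
    intro lam hlam
    rw [mem_closedBall_zero_iff, Real.norm_eq_abs, le_div_iff₀ (abs_pos.2 hi₀), ← abs_mul]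
    have hQ : 0 ≤ (∑ i, q i) / q i₀ :=
      div_nonneg (Finset.sum_nonneg fun i _ => (hq i).le) (hq i₀).le
    have h1 : q i₀ * (1 + lam * w i₀) ≤ ∑ i, q i := by
      calc q i₀ * (1 + lam * w i₀) ≤ ∑ i, q i * (1 + lam * w i) :=
            Finset.single_le_sum (f := fun i => q i * (1 + lam * w i))
              (fun i _ => mul_nonneg (hq i).le (hlam i)) (Finset.mem_univ i₀)
        _ = ∑ i, q i := by
            have : ∀ i, q i * (1 + lam * w i) = q i + lam * (q i * w i) := fun i => by ring
            simp only [this, Finset.sum_add_distrib, ← Finset.mul_sum, hqw]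
            ring
    have h2 : 1 + lam * w i₀ ≤ (∑ i, q i) / q i₀ := by
      rw [le_div_iff₀ (hq i₀)]; linarith
    have h3 := hlam i₀
    rw [abs_le]; constructor <;> linarith
  have hKcompact : IsCompact K :=
    (isCompact_closedBall _ _).of_isClosed_subset hKclosed hKbdd
  -- The product is `1` at `lam = 0` and vanishes where some factor does, so its maximizer has all
  -- factors positive and is a critical point of the log.
  obtain ⟨lam, hlamK, hmax⟩ := hKcompact.exists_isMaxOn (f := fun lam => ∏ i, (1 + lam * w i))
    ⟨0, by simp [hK]⟩ (by fun_prop)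
  have h1 : 1 ≤ ∏ i, (1 + lam * w i) := by
    have := hmax (show (0 : ℝ) ∈ K by simp [hK])
    simpa using this
  have hpos : ∀ i, 0 < 1 + lam * w i := fun i => by
    refine lt_of_le_of_ne (hlamK i) fun h => ?_
    rw [Finset.prod_eq_zero (Finset.mem_univ i) h.symm] at h1
    exact absurd h1 (by norm_num)
  have hev : ∀ᶠ x in 𝓝 lam, ∀ i, 0 < 1 + x * w i := by
    rw [eventually_all]
    intro i
    exact continuousAt_const.eventually_lt (by fun_prop) (hpos i)
  have hloc : IsLocalMax (fun x => ∑ i, Real.log (1 + x * w i)) lam := by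
    filter_upwards [hev] with x hx
    rw [← Real.log_prod fun i _ => (hx i).ne', ← Real.log_prod fun i _ => (hpos i).ne']
    exact Real.log_le_log (Finset.prod_pos fun i _ => hx i) (hmax fun i => (hx i).le)
  have hder : HasDerivAt (fun x => ∑ i, Real.log (1 + x * w i))
      (∑ i, w i / (1 + lam * w i)) lam := by
    refine HasDerivAt.fun_sum fun i _ => ?_
    have : HasDerivAt (fun x : ℝ => 1 + x * w i) (w i) lam := by
      simpa using ((hasDerivAt_id lam).mul_const (w i)).const_add 1
    exact this.log (hpos i).ne'
  exact ⟨lam, hpos, hloc.hasDerivAt_eq_zero hder⟩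

theorem adjLevel_pos (n : ℕ) : 0 < adjLevel n := lt_of_lt_of_le one_pos (le_max_left _ _)

theorem exists_isMultiplier_adjoinPseudo {n : ℕ} (w : Fin n → ℝ) :
    ∃ lam, IsMultiplier (adjoinPseudo w) lam := by
  rcases Nat.eq_zero_or_pos n with rfl | hn
  · refine exists_isMultiplier _ (fun _ => 1) (by simp) ?_
    simp [adjoinPseudo, Fin.snoc]
  have hn' : (0 : ℝ) < n := by exact_mod_cast hn
  -- The pseudo-value is built to be balanced by weight `a_n / n` on each score.
  refine exists_isMultiplier _ (Fin.snoc (α := fun _ => ℝ) (fun _ => adjLevel n / n) 1) ?_ ?_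
  · intro i
    refine Fin.lastCases ?_ (fun j => ?_) i
    · simp
    · simpa using div_pos (adjLevel_pos n) hn'
  · rw [Fin.sum_univ_castSucc]
    simp only [adjoinPseudo, Fin.snoc_castSucc, Fin.snoc_last, ← Finset.mul_sum]
    ring

/-! ### Quadratic expansion of the log-likelihood ratio -/

/-- Subtracting `u / (1 + u)` instead of `u` is free: these terms sum to zero by the multiplier
equation. -/
theorem abs_log_one_add_sub_le {u : ℝ} (hu : |u| ≤ 1 / 2) :
    |2 * (Real.log (1 + u) - u / (1 + u)) - u ^ 2| ≤ 8 * |u| ^ 3 := by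
  have h1 := Real.abs_log_sub_add_sum_range_le (x := -u) (by rw [abs_neg]; linarith) 2
  simp only [Finset.sum_range_succ, Finset.sum_range_zero, abs_neg, sub_neg_eq_add] at h1
  norm_num at h1
  have hpos : 0 < 1 + u := by have := (abs_le.1 hu).1; linarith
  have h3 : |u| ^ 3 / (1 - |u|) ≤ 2 * |u| ^ 3 := by
    rw [div_le_iff₀ (by linarith)]
    nlinarith [pow_nonneg (abs_nonneg u) 3]
  have h4 : |u ^ 3 / (1 + u)| ≤ 2 * |u| ^ 3 := by
    rw [abs_div, abs_pow, abs_of_pos hpos, div_le_iff₀ hpos]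
    have := (abs_le.1 hu).1
    nlinarith [pow_nonneg (abs_nonneg u) 3]
  have h5 : u / (1 + u) = u - u ^ 2 + u ^ 3 / (1 + u) := by field_simp; ring
  have h6 := abs_le.1 (h1.trans h3)
  have h7 := abs_le.1 h4
  rw [h5, abs_le]
  constructor <;> linarith [h6.1, h6.2, h7.1, h7.2]

theorem IsMultiplier.sum_eq {m : ℕ} {w : Fin m → ℝ} {lam : ℝ} (h : IsMultiplier w lam) :
    ∑ i, w i = lam * ∑ i, w i ^ 2 / (1 + lam * w i) := by
  have : ∀ i, w i / (1 + lam * w i) = w i - lam * (w i ^ 2 / (1 + lam * w i)) := fun i => by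
    have := (h.1 i).ne'
    rw [div_eq_iff this, sub_mul, mul_assoc, div_mul_cancel₀ _ this]
    ring
  have h2 := h.2
  simp only [this, Finset.sum_sub_distrib, ← Finset.mul_sum] at h2
  linarith

/-- Quantitative quadratic expansion of the empirical log-likelihood ratio. -/
theorem IsMultiplier.abs_sub_le {m : ℕ} {w : Fin m → ℝ} {lam z M b : ℝ} (h : IsMultiplier w lam)
    (hz : 0 ≤ z) (hwz : ∀ i, |w i| ≤ z) (hA : |∑ i, w i| ≤ M) (hb : 0 < b)
    (hB : b ≤ ∑ i, w i ^ 2) (hMz : 4 * (M * z) ≤ b) :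
    |2 * ∑ i, Real.log (1 + lam * w i) - (∑ i, w i) ^ 2 / ∑ i, w i ^ 2| ≤
      88 * M ^ 3 * z / b ^ 2 := by
  set A := ∑ i, w i with hAdef
  set B := ∑ i, w i ^ 2 with hBdef
  have hB0 : 0 < B := hb.trans_le hB
  have hM : 0 ≤ M := (abs_nonneg _).trans hA
  have hsq : A = lam * ∑ i, w i ^ 2 / (1 + lam * w i) := h.sum_eq
  -- a first bound on the multiplier
  have hlamB : |lam| * B ≤ |A| * (1 + |lam| * z) := by
    have : B ≤ (1 + |lam| * z) * ∑ i, w i ^ 2 / (1 + lam * w i) := by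
      rw [hBdef, Finset.mul_sum]
      refine Finset.sum_le_sum fun i _ => ?_
      rw [mul_div_assoc', le_div_iff₀ (h.1 i), mul_comm]
      refine mul_le_mul_of_nonneg_right ?_ (sq_nonneg _)
      have := (le_abs_self (lam * w i)).trans_eq (abs_mul _ _)
      have := mul_le_mul_of_nonneg_left (hwz i) (abs_nonneg lam)
      linarith
    have hnn : 0 ≤ ∑ i, w i ^ 2 / (1 + lam * w i) :=
      Finset.sum_nonneg fun i _ => div_nonneg (sq_nonneg _) (h.1 i).le
    rw [hsq, abs_mul, abs_of_nonneg hnn]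
    nlinarith [abs_nonneg lam]
  -- Since `4 M z ≤ b`, the term `M |lam| z` is at most `|lam| b / 4` and is absorbed on the left.
  have hlamb : |lam| * b ≤ 2 * M := by
    have h1 : |lam| * b ≤ M * (1 + |lam| * z) :=
      (mul_le_mul_of_nonneg_left hB (abs_nonneg _)).trans
        (hlamB.trans (mul_le_mul_of_nonneg_right hA (by positivity)))
    nlinarith [mul_le_mul_of_nonneg_left hMz (abs_nonneg lam)]
  set δ := 2 * M * z / b with hδ
  have hδ0 : 0 ≤ δ := by positivity
  have hδ2 : δ ≤ 1 / 2 := by rw [hδ, div_le_iff₀ hb]; linarith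
  have hlamz : |lam| * z ≤ δ := by
    rw [hδ, le_div_iff₀ hb]
    nlinarith
  have hu : ∀ i, |lam * w i| ≤ δ := fun i => by
    rw [abs_mul]
    exact (mul_le_mul_of_nonneg_left (hwz i) (abs_nonneg lam)).trans hlamz
  have hlamB2 : |lam| * B ≤ 2 * M := by nlinarith [abs_nonneg A]
  -- the linear term
  have hlin : |A - lam * B| ≤ 2 * δ * (|lam| * B) := by
    have h1 : A - lam * B = -lam * ∑ i, w i ^ 2 * (lam * w i / (1 + lam * w i)) := by
      rw [hsq, hBdef, neg_mul, ← mul_neg, ← mul_sub, ← Finset.sum_sub_distrib,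
        ← Finset.sum_neg_distrib]
      congr 1
      refine Finset.sum_congr rfl fun i _ => ?_
      have := (h.1 i).ne'
      rw [mul_div_assoc', ← neg_div, eq_div_iff this, sub_mul, div_mul_cancel₀ _ this]
      ring
    have h2 : |∑ i, w i ^ 2 * (lam * w i / (1 + lam * w i))| ≤ B * (2 * δ) := by
      rw [hBdef, Finset.sum_mul]
      refine (Finset.abs_sum_le_sum_abs _ _).trans (Finset.sum_le_sum fun i _ => ?_)
      rw [abs_mul, abs_of_nonneg (sq_nonneg (w i))]
      refine mul_le_mul_of_nonneg_left ?_ (sq_nonneg _)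
      rw [abs_div, abs_of_pos (h.1 i), div_le_iff₀ (h.1 i)]
      have := (abs_le.1 (hu i)).1
      nlinarith [hu i]
    rw [h1, abs_mul, abs_neg]
    calc _ ≤ |lam| * (B * (2 * δ)) := mul_le_mul_of_nonneg_left h2 (abs_nonneg _)
      _ = _ := by ring
  -- the quadratic term
  have hquad : |2 * ∑ i, Real.log (1 + lam * w i) - lam ^ 2 * B| ≤ 8 * δ * (lam ^ 2 * B) := by
    have h1 : 2 * ∑ i, Real.log (1 + lam * w i) - lam ^ 2 * B =
        ∑ i, (2 * (Real.log (1 + lam * w i) - lam * w i / (1 + lam * w i)) - (lam * w i) ^ 2) := by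
      have h2 : ∑ i, lam * w i / (1 + lam * w i) = 0 := by
        simp only [mul_div_assoc, ← Finset.mul_sum, h.2, mul_zero]
      simp only [Finset.sum_sub_distrib, ← Finset.mul_sum, h2, mul_pow, hBdef, sub_zero]
    rw [h1, hBdef, Finset.mul_sum, Finset.mul_sum]
    refine (Finset.abs_sum_le_sum_abs _ _).trans (Finset.sum_le_sum fun i _ => ?_)
    refine (abs_log_one_add_sub_le ((hu i).trans hδ2)).trans ?_
    rw [← mul_pow, ← sq_abs (lam * w i)]
    nlinarith [mul_le_mul_of_nonneg_left (hu i) (sq_nonneg |lam * w i|)]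
  have hlamlam : lam ^ 2 * B ≤ 4 * M ^ 2 / b := by
    rw [le_div_iff₀ hb, ← sq_abs lam]
    calc |lam| ^ 2 * B * b = (|lam| * B) * (|lam| * b) := by ring
      _ ≤ (2 * M) * (2 * M) := mul_le_mul hlamB2 hlamb (by positivity) (by positivity)
      _ = 4 * M ^ 2 := by ring
  have hdiff : |lam ^ 2 * B - A ^ 2 / B| ≤ 2 * δ * (3 * M * (2 * M / b)) := by
    have h1 : lam ^ 2 * B - A ^ 2 / B = -((A - lam * B) * (A + lam * B) / B) := by
      field_simp
      ring
    have h2 : |A + lam * B| ≤ 3 * M := by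
      refine (abs_add_le _ _).trans ?_
      rw [abs_mul, abs_of_pos hB0]
      linarith
    have h3 : |lam| ≤ 2 * M / b := by rwa [le_div_iff₀ hb]
    rw [h1, abs_neg, abs_div, abs_mul, abs_of_pos hB0, div_le_iff₀ hB0]
    calc |A - lam * B| * |A + lam * B| ≤ 2 * δ * (|lam| * B) * (3 * M) :=
          mul_le_mul hlin h2 (abs_nonneg _) (by positivity)
      _ ≤ 2 * δ * (2 * M / b * B) * (3 * M) := by gcongr
      _ = _ := by ring
  -- `88 = 64 + 24`: the first comes from expanding the log, the second from replacing `lam² B` by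
  -- `A² / B`.
  calc _ ≤ |2 * ∑ i, Real.log (1 + lam * w i) - lam ^ 2 * B| + |lam ^ 2 * B - A ^ 2 / B| :=
        _root_.abs_sub_le _ _ _
    _ ≤ 8 * δ * (4 * M ^ 2 / b) + 2 * δ * (3 * M * (2 * M / b)) := by
        refine add_le_add (hquad.trans ?_) hdiff
        exact mul_le_mul_of_nonneg_left hlamlam (by positivity)
    _ = _ := by rw [hδ]; field_simp; ring

/-- The ratio depends only on the products `lam * w i`, so scores may be normalized freely. -/
theorem IsMultiplier.div_const {m : ℕ} {w : Fin m → ℝ} {lam r : ℝ} (hr : r ≠ 0)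
    (h : IsMultiplier w lam) : IsMultiplier (fun i => w i / r) (r * lam) := by
  have h1 : ∀ i, r * lam * (w i / r) = lam * w i := fun i => by field_simp
  refine ⟨fun i => by rw [h1]; exact h.1 i, ?_⟩
  have h2 : ∀ i, w i / r / (1 + r * lam * (w i / r)) = r⁻¹ * (w i / (1 + lam * w i)) := fun i => by
    rw [h1]; ring
  simp only [h2, ← Finset.mul_sum, h.2, mul_zero]

/-- Asymptotic quadratic form of the empirical log-likelihood ratio of a triangular array. -/
theorem tendsto_empLogLikRatio_sub {ι : Type*} {l : Filter ι} {m : ι → ℕ}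
    (w : ∀ j, Fin (m j) → ℝ) (r : ι → ℝ) (hm : ∀ j, m j ≠ 0) (hr : ∀ᶠ j in l, 0 < r j)
    (hex : ∀ j, ∃ lam, IsMultiplier (w j) lam) {M v : ℝ} (hv : 0 < v)
    (hA : ∀ᶠ j in l, |(∑ i, w j i) / r j| ≤ M)
    (hB : Tendsto (fun j => (∑ i, w j i ^ 2) / r j ^ 2) l (𝓝 v))
    (hmax : ∀ z > 0, ∀ᶠ j in l, ∀ i, |w j i| ≤ z * r j) :
    Tendsto (fun j => empLogLikRatio (w j) - ((∑ i, w j i) / r j) ^ 2 / v) l (𝓝 0) := by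
  have h1 : Tendsto (fun j => empLogLikRatio (w j) -
      ((∑ i, w j i) / r j) ^ 2 / ((∑ i, w j i ^ 2) / r j ^ 2)) l (𝓝 0) := by
    rw [Metric.tendsto_nhds]
    intro ε hε
    have hz : ∀ᶠ z : ℝ in 𝓝[>] 0, 4 * (M * z) < v / 2 ∧ 88 * M ^ 3 * z / (v / 2) ^ 2 < ε := by
      have t1 : Tendsto (fun z : ℝ => 4 * (M * z)) (𝓝[>] 0) (𝓝 (4 * (M * 0))) :=
        (Continuous.tendsto (by fun_prop) 0).mono_left nhdsWithin_le_nhds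
      have t2 : Tendsto (fun z : ℝ => 88 * M ^ 3 * z / (v / 2) ^ 2) (𝓝[>] 0)
          (𝓝 (88 * M ^ 3 * 0 / (v / 2) ^ 2)) :=
        (Continuous.tendsto (by fun_prop) 0).mono_left nhdsWithin_le_nhds
      exact (t1.eventually_lt_const (by simpa using hv)).and
        (t2.eventually_lt_const (by simpa using hε))
    obtain ⟨z, ⟨hz1, hz2⟩, hz0 : 0 < z⟩ := (hz.and self_mem_nhdsWithin).exists
    filter_upwards [hr, hA, hB.eventually_const_lt (half_lt_self hv), hmax z hz0]
      with j hrj hAj hBj hmj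
    obtain ⟨lam, hlam⟩ := hex j
    have key := (hlam.div_const hrj.ne').abs_sub_le hz0.le (M := M) (b := v / 2)
      (fun i => by
        rw [abs_div, abs_of_pos hrj, div_le_iff₀ hrj]; exact hmj i)
      (by rwa [← Finset.sum_div]) (half_pos hv)
      (by simp only [div_pow, ← Finset.sum_div]; exact hBj.le) hz1.le
    have hs : ∀ i, r j * lam * (w j i / r j) = lam * w j i := fun i => by
      have := hrj.ne'
      field_simp
    rw [Real.dist_eq, sub_zero, hlam.empLogLikRatio_eq (hm j)]
    simp only [hs, div_pow, ← Finset.sum_div] at key hz2 ⊢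
    exact key.trans_lt hz2
  have h2 : Tendsto (fun j => ((∑ i, w j i) / r j) ^ 2 *
      (((∑ i, w j i ^ 2) / r j ^ 2)⁻¹ - v⁻¹)) l (𝓝 0) := by
    refine bdd_le_mul_tendsto_zero' (M ^ 2) ?_ ?_
    · filter_upwards [hA] with j hj
      rw [abs_pow]
      exact pow_le_pow_left₀ (abs_nonneg _) hj 2
    · simpa using (hB.inv₀ hv.ne').sub_const v⁻¹
  convert h1.add h2 using 2 <;> ring

/-! ### Negligibility of the pseudo-value and of the transformation -/

theorem tendsto_adjLevel_div : Tendsto (fun n : ℕ => adjLevel n / n) atTop (𝓝 0) := by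
  have h1 : Tendsto (fun n : ℕ => (1 : ℝ) / n) atTop (𝓝 0) := tendsto_one_div_atTop_nhds_zero_nat
  have h2 : Tendsto (fun n : ℕ => Real.log n / n) atTop (𝓝 0) :=
    (Real.isLittleO_log_id_atTop.tendsto_div_nhds_zero).comp tendsto_natCast_atTop_atTop
  have h3 := h1.max (h2.div_const 2)
  simp only [zero_div, max_self] at h3
  refine h3.congr fun n => ?_
  rw [adjLevel, div_right_comm, max_div_div_right (Nat.cast_nonneg n)]

theorem tendsto_transform {l : Filter ℕ} (hl : l ≤ atTop) {L T : ℕ → ℝ} {v M : ℝ}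
    (hL : Tendsto (fun n => L n - T n ^ 2 / v) l (𝓝 0)) (hT : ∀ᶠ n in l, |T n| ≤ M) :
    Tendsto (fun n => L n * max (1 - L n / n) (1 / 2) - T n ^ 2 / v) l (𝓝 0) := by
  have hLb : ∀ᶠ n in l, |L n| ≤ 1 + M ^ 2 / |v| := by
    filter_upwards [hL.eventually (Metric.ball_mem_nhds (0 : ℝ) one_pos), hT] with n hn hTn
    rw [Real.dist_eq, sub_zero] at hn
    have h2 : |T n ^ 2 / v| ≤ M ^ 2 / |v| := by
      rw [abs_div, abs_pow]
      gcongr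
    calc |L n| = |(L n - T n ^ 2 / v) + T n ^ 2 / v| := by ring_nf
      _ ≤ _ := (abs_add_le _ _).trans (add_le_add hn.le h2)
  have hn0 : Tendsto (fun n : ℕ => ((n : ℝ))⁻¹) l (𝓝 0) :=
    (tendsto_inv_atTop_nhds_zero_nat (𝕜 := ℝ)).mono_left hl
  have hLn : Tendsto (fun n => L n / n) l (𝓝 0) := bdd_le_mul_tendsto_zero' _ hLb hn0
  have hmax : Tendsto (fun n => max (1 - L n / n) (1 / 2) - 1) l (𝓝 0) := by
    have := ((hLn.const_sub 1).max (tendsto_const_nhds (x := (1 / 2 : ℝ)))).sub_const 1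
    norm_num at this ⊢
    exact this
  convert hL.add (bdd_le_mul_tendsto_zero' _ hLb hmax) using 2 <;> ring

/-- The normalized sum is only tight, so along a path the limit is taken over the indices where it
is at most `M`. There the pseudo-value is `o(√n)`, shifting neither the normalized sum nor the mean
square in the limit. -/
theorem tendsto_transformed_adjusted {s : ∀ n : ℕ, Fin n → ℝ} {v : ℝ} (hv : 0 < v)
    (hS : Tendsto (fun n => (∑ i, s n i ^ 2) / n) atTop (𝓝 v))
    (hmax : ∀ z > 0, ∀ᶠ n : ℕ in atTop, ∀ i, |s n i| ≤ z * √n) (M : ℝ) :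
    Tendsto (fun n : ℕ => empLogLikRatio (adjoinPseudo (s n)) *
        max (1 - empLogLikRatio (adjoinPseudo (s n)) / n) (1 / 2) - ((∑ i, s n i) / √n) ^ 2 / v)
      (atTop ⊓ 𝓟 {n : ℕ | |(∑ i, s n i) / √n| ≤ M}) (𝓝 0) := by
  set T : ℕ → ℝ := fun n => (∑ i, s n i) / √n with hTdef
  set l : Filter ℕ := atTop ⊓ 𝓟 {n : ℕ | |T n| ≤ M} with hl
  have hle : l ≤ atTop := inf_le_left
  have hT : ∀ᶠ n in l, |T n| ≤ M := mem_inf_of_right (mem_principal_self _)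
  have ha := tendsto_adjLevel_div.mono_left hle
  have hpos : ∀ᶠ n : ℕ in l, 0 < √(n : ℝ) := hle <| by
    filter_upwards [eventually_gt_atTop 0] with n hn
    exact Real.sqrt_pos.2 (by exact_mod_cast hn)
  have haT : Tendsto (fun n => T n * (adjLevel n / n)) l (𝓝 0) :=
    bdd_le_mul_tendsto_zero' M hT ha
  have hsum : ∀ᶠ n : ℕ in l,
      (∑ i, adjoinPseudo (s n) i) / √n = T n - T n * (adjLevel n / n) := by
    filter_upwards [hpos] with n hn
    rw [Fin.sum_univ_castSucc]
    simp only [adjoinPseudo, Fin.snoc_castSucc, Fin.snoc_last, hTdef]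
    ring
  refine tendsto_transform hle ?_ hT
  have hmain := tendsto_empLogLikRatio_sub (l := l) (fun n => adjoinPseudo (s n))
    (fun n => √(n : ℝ)) (fun n => Nat.succ_ne_zero n) hpos
    (fun n => exists_isMultiplier_adjoinPseudo (s n)) (M := M + 1) hv ?_ ?_ ?_
  · have h2 : Tendsto (fun n => (-(2 * T n) + T n * (adjLevel n / n)) / v *
        (T n * (adjLevel n / n))) l (𝓝 0) := by
      refine bdd_le_mul_tendsto_zero' ((2 * M + 1) / v) ?_ haT
      filter_upwards [hT, haT.eventually (Metric.ball_mem_nhds (0 : ℝ) one_pos)] with n h1 h2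
      rw [Real.dist_eq, sub_zero] at h2
      rw [abs_div, abs_of_pos hv]
      gcongr
      refine (abs_add_le _ _).trans (add_le_add ?_ h2.le)
      rw [abs_neg, abs_mul, abs_two]
      linarith
    have h3 := hmain.add h2
    rw [add_zero] at h3
    refine h3.congr' ?_
    filter_upwards [hsum] with n hn
    rw [hn]
    ring
  · filter_upwards [hsum, hT, haT.eventually (Metric.ball_mem_nhds (0 : ℝ) one_pos)] with n h h1 h2
    rw [Real.dist_eq, sub_zero] at h2
    rw [h]
    exact (abs_sub _ _).trans (add_le_add h1 h2.le)
  · have h1 := (hS.mono_left hle).add (haT.pow 2)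
    rw [zero_pow two_ne_zero, add_zero] at h1
    refine h1.congr' ?_
    filter_upwards [hpos] with n hn
    rw [Fin.sum_univ_castSucc]
    simp only [adjoinPseudo, Fin.snoc_castSucc, Fin.snoc_last, hTdef, mul_pow, div_pow, neg_sq,
      Real.sq_sqrt (Nat.cast_nonneg n)]
    ring
  · intro z hz
    filter_upwards [hle (hmax z hz), hpos,
      haT.eventually (Metric.ball_mem_nhds (0 : ℝ) hz)] with n h1 hn h2 i
    rw [Real.dist_eq, sub_zero] at h2
    refine Fin.lastCases ?_ (fun j => ?_) i
    · simp only [adjoinPseudo, Fin.snoc_last]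
      have : -adjLevel n * (1 / (n : ℝ) * ∑ i, s n i) = -(T n * (adjLevel n / n)) * √n := by
        simp only [hTdef]
        field_simp
      rw [this, abs_mul, abs_neg, abs_of_pos hn]
      exact mul_le_mul_of_nonneg_right h2.le hn.le
    · simpa [adjoinPseudo] using h1 j

/-! ### Sample quantiles of a fixed sample -/

section Sample

variable {n : ℕ} (x : Fin n → ℝ)

theorem card_le_eq_mul_empCDF (y : ℝ) :
    ((Finset.univ.filter (fun i => x i ≤ y)).card : ℝ) = n * empCDF x y := by
  rcases Nat.eq_zero_or_pos n with rfl | hn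
  · simp
  · have : (n : ℝ) ≠ 0 := by exact_mod_cast hn.ne'
    rw [empCDF, mul_div_cancel₀ _ this]

theorem monotone_empCDF : Monotone (empCDF x) := by
  intro a b hab
  unfold empCDF
  gcongr with i hi

theorem sum_indicator_one (y : ℝ) :
    ∑ i, (Set.Iic y).indicator (fun _ => (1 : ℝ)) (x i) = n * empCDF x y := by
  rw [← card_le_eq_mul_empCDF]
  simp [Set.indicator_apply]

variable {x} {t : ℝ}

theorem empCDF_quantile_set_nonempty (hn : n ≠ 0) (ht : t ≤ 1) : {y | t ≤ empCDF x y}.Nonempty := by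
  obtain ⟨b, hb⟩ := (Set.finite_range x).bddAbove
  refine ⟨b, ?_⟩
  have : ∀ i, x i ≤ b := fun i => hb ⟨i, rfl⟩
  have hn' : (n : ℝ) ≠ 0 := by exact_mod_cast hn
  simpa [empCDF, this, hn'] using ht

theorem empCDF_quantile_set_bddBelow (ht : 0 < t) : BddBelow {y | t ≤ empCDF x y} := by
  obtain ⟨b, hb⟩ := (Set.finite_range x).bddBelow
  refine ⟨b, fun y hy => ?_⟩
  by_contra! h
  have : ∀ i, ¬ x i ≤ y := fun i => not_le.2 (h.trans_le (hb ⟨i, rfl⟩))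
  have h0 : empCDF x y = 0 := by simp [empCDF, this]
  rw [Set.mem_ofPred_eq, h0] at hy
  exact absurd ht (not_lt.2 hy)

/-- The empirical distribution function is constant just to the right of any point, so the infimum
is attained. -/
theorem le_empCDF_quantile (hn : n ≠ 0) (ht : t ≤ 1) :
    t ≤ empCDF x (quantile (empCDF x) t) := by
  set q := quantile (empCDF x) t with hq
  have h1 : ∀ᶠ y in 𝓝[>] q, ∀ i, (x i ≤ y ↔ x i ≤ q) := by
    rw [eventually_all]
    intro i
    rcases le_or_gt (x i) q with h | h
    · filter_upwards [self_mem_nhdsWithin] with y (hy : q < y)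
      simp [h, h.trans hy.le]
    · filter_upwards [nhdsWithin_le_nhds (Iio_mem_nhds h)] with y (hy : y < x i)
      simp only [not_le.2 h, not_le.2 hy]
  obtain ⟨y, hy, hqy : q < y⟩ := (h1.and self_mem_nhdsWithin).exists
  obtain ⟨z, hz, hzy⟩ := exists_lt_of_csInf_lt (empCDF_quantile_set_nonempty hn ht) hqy
  have h2 : t ≤ empCDF x y := le_trans hz (monotone_empCDF x hzy.le)
  have h3 : empCDF x y = empCDF x q := by simp only [empCDF, hy]
  rwa [← h3]

theorem quantile_empCDF_le_iff (hn : n ≠ 0) (ht0 : 0 < t) (ht : t ≤ 1) (y : ℝ) :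
    quantile (empCDF x) t ≤ y ↔ t ≤ empCDF x y :=
  ⟨fun h => (le_empCDF_quantile hn ht).trans (monotone_empCDF x h),
    fun h => csInf_le (empCDF_quantile_set_bddBelow ht0) h⟩

theorem card_lt_quantile_lt (hn : n ≠ 0) (ht0 : 0 < t) (ht : t ≤ 1) :
    ((Finset.univ.filter (fun i => x i < quantile (empCDF x) t)).card : ℝ) < n * t := by
  set q := quantile (empCDF x) t with hq
  have h1 : ∀ᶠ y in 𝓝[<] q, ∀ i, (x i ≤ y ↔ x i < q) := by
    rw [eventually_all]
    intro i
    rcases lt_or_ge (x i) q with h | h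
    · filter_upwards [nhdsWithin_le_nhds (Ioi_mem_nhds h)] with y (hy : x i < y)
      simp [h, hy.le]
    · filter_upwards [self_mem_nhdsWithin] with y (hy : y < q)
      simp only [not_lt.2 h, not_le.2 (hy.trans_le h)]
  obtain ⟨y, hy, hqy : y < q⟩ := (h1.and self_mem_nhdsWithin).exists
  have h2 : empCDF x y < t := by
    by_contra! h
    exact absurd hqy (not_lt.2 ((quantile_empCDF_le_iff hn ht0 ht y).2 h))
  have hn' : (0 : ℝ) < n := by exact_mod_cast Nat.pos_of_ne_zero hn
  simp only [← hy]
  rw [card_le_eq_mul_empCDF]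
  exact mul_lt_mul_of_pos_left h2 hn'

/-- Fewer than `n t` observations lie strictly below the sample quantile, and without ties at most
one lies on it. -/
theorem empCDF_quantile_le (hn : n ≠ 0) (ht0 : 0 < t) (ht : t ≤ 1)
    (hinj : ∀ i j, x i = quantile (empCDF x) t → x j = quantile (empCDF x) t → i = j) :
    n * empCDF x (quantile (empCDF x) t) ≤ n * t + 1 := by
  set q := quantile (empCDF x) t with hq
  have h1 := card_lt_quantile_lt (x := x) hn ht0 ht
  rw [← hq] at h1
  have h2 : Finset.univ.filter (fun i => x i ≤ q) ⊆
      Finset.univ.filter (fun i => x i < q) ∪ Finset.univ.filter (fun i => x i = q) := by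
    intro i
    simp [le_iff_lt_or_eq]
  have h3 : (Finset.univ.filter (fun i => x i = q)).card ≤ 1 := by
    rw [Finset.card_le_one]
    intro i hi j hj
    exact hinj i j (by simpa using hi) (by simpa using hj)
  have h4 := (Finset.card_le_card h2).trans (Finset.card_union_le _ _)
  rw [← card_le_eq_mul_empCDF]
  have h5 : ((Finset.univ.filter (fun i => x i ≤ q)).card : ℝ) ≤
      (Finset.univ.filter (fun i => x i < q)).card + 1 := by exact_mod_cast h4.trans (by omega)
  linarith

/-- Moving the truncation point changes a truncated sum by at most the number of observations
crossed times the size of the summand there. -/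
theorem abs_sum_indicator_sub_le (g : ℝ → ℝ) {a b C : ℝ}
    (hg : ∀ y ∈ Set.uIoc a b, |g y| ≤ C) :
    |∑ i, (Set.Iic a).indicator g (x i) - ∑ i, (Set.Iic b).indicator g (x i)| ≤
      C * |n * empCDF x a - n * empCDF x b| := by
  wlog hab : a ≤ b generalizing a b
  · rw [abs_sub_comm, abs_sub_comm (n * empCDF x a)]
    exact this (by rwa [Set.uIoc_comm]) (le_of_not_ge hab)
  have hmono := mul_le_mul_of_nonneg_left (monotone_empCDF x hab) (Nat.cast_nonneg (α := ℝ) n)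
  rw [abs_sub_comm, abs_sub_comm (n * empCDF x a), abs_of_nonneg (sub_nonneg.2 hmono),
    ← sum_indicator_one, ← sum_indicator_one, ← Finset.sum_sub_distrib, ← Finset.sum_sub_distrib,
    Finset.mul_sum]
  refine (Finset.abs_sum_le_sum_abs _ _).trans (Finset.sum_le_sum fun i _ => ?_)
  rw [Set.uIoc_of_le hab] at hg
  simp only [Set.indicator_apply, Set.mem_Iic]
  rcases le_or_gt (x i) a with h | h
  · simp [h, h.trans hab]
  · rcases le_or_gt (x i) b with h' | h'
    · simpa [h, h', not_le.2 h] using hg _ ⟨h, h'⟩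
    · simp [not_le.2 h, not_le.2 h']

end Sample

/-! ### Deterministic limits along one sequence -/

section Sequence

variable {x : ℕ → ℝ} {t ψ : ℝ}

/-- Only the points `ψ ± 1 / (k + 1)` are tested, so that countably many applications of the strong
law suffice. -/
theorem tendsto_quantile_empCDF (ht0 : 0 < t) (ht1 : t ≤ 1)
    (hlow : ∀ k : ℕ, ∃ c < t, Tendsto
      (fun n => empCDF (fun i : Fin n => x i) (ψ - 1 / ((k : ℝ) + 1))) atTop (𝓝 c))
    (hup : ∀ k : ℕ, ∃ c > t, Tendsto
      (fun n => empCDF (fun i : Fin n => x i) (ψ + 1 / ((k : ℝ) + 1))) atTop (𝓝 c)) :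
    Tendsto (fun n => quantile (empCDF (fun i : Fin n => x i)) t) atTop (𝓝 ψ) := by
  rw [Metric.tendsto_nhds]
  intro ε hε
  obtain ⟨k, hk⟩ := exists_nat_one_div_lt hε
  obtain ⟨c, hc, hlc⟩ := hlow k
  obtain ⟨d, hd, hld⟩ := hup k
  filter_upwards [hlc.eventually_lt_const hc, hld.eventually_const_lt hd, eventually_ne_atTop 0]
    with n h1 h2 hn
  have h3 := (quantile_empCDF_le_iff hn ht0 ht1 _).2 h2.le
  have h4 := not_le.1 (mt (quantile_empCDF_le_iff hn ht0 ht1 _).1 (not_le.2 h1))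
  rw [Real.dist_eq, abs_lt]
  constructor <;> linarith

/-- Late indices satisfy `|x i| ≤ z √i ≤ z √n`; the finitely many early ones are beaten by `√n → ∞`.
-/
theorem eventually_abs_le_mul_sqrt (hx : Tendsto (fun n : ℕ => x n ^ 2 / n) atTop (𝓝 0))
    {z : ℝ} (hz : 0 < z) : ∀ᶠ n : ℕ in atTop, ∀ i < n, |x i| ≤ z * √n := by
  obtain ⟨N, hN⟩ := eventually_atTop.1 ((hx.eventually_lt_const (pow_pos hz 2)).and
    (eventually_gt_atTop 0))
  have h1 : ∀ᶠ n : ℕ in atTop, ∀ i ∈ Finset.range N, |x i| ≤ z * √n := by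
    rw [Filter.eventually_all_finset]
    intro i _
    have : Tendsto (fun n : ℕ => z * √(n : ℝ)) atTop atTop :=
      (Real.tendsto_sqrt_atTop.comp tendsto_natCast_atTop_atTop).const_mul_atTop hz
    exact this.eventually_ge_atTop _
  filter_upwards [h1] with n hn i hi
  rcases lt_or_ge i N with h | h
  · exact hn i (Finset.mem_range.2 h)
  · obtain ⟨h2, h3⟩ := hN i h
    have h3' : (0 : ℝ) < i := by exact_mod_cast h3
    rw [div_lt_iff₀ h3'] at h2
    have h4 : |x i| ≤ z * √i := by
      refine abs_le_of_sq_le_sq ?_ (by positivity)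
      rw [mul_pow, Real.sq_sqrt h3'.le]
      exact h2.le
    refine h4.trans (mul_le_mul_of_nonneg_left (Real.sqrt_le_sqrt ?_) hz.le)
    exact_mod_cast hi.le

/-- Consecutive partial sums differ by `y n`. Applied to squares, this derives the maximal bound on
the scores from the strong law. -/
theorem tendsto_sq_div_of_tendsto_mean {y : ℕ → ℝ} {c : ℝ}
    (h : Tendsto (fun n : ℕ => (∑ i ∈ Finset.range n, y i) / n) atTop (𝓝 c)) :
    Tendsto (fun n : ℕ => y n / n) atTop (𝓝 0) := by
  have h1 := (tendsto_add_atTop_iff_nat 1).2 h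
  have h2 : Tendsto (fun n : ℕ => ((n : ℝ) + 1) / n) atTop (𝓝 1) := by
    have := (tendsto_inv_atTop_nhds_zero_nat (𝕜 := ℝ)).const_add 1
    rw [add_zero] at this
    refine this.congr' ?_
    filter_upwards [eventually_gt_atTop 0] with n hn
    have : (n : ℝ) ≠ 0 := by exact_mod_cast hn.ne'
    field_simp
  have h3 := (h1.mul h2).sub h
  rw [mul_one, sub_self] at h3
  refine h3.congr' ?_
  filter_upwards [eventually_gt_atTop 0] with n hn
  have : (n : ℝ) ≠ 0 := by exact_mod_cast hn.ne'
  rw [Finset.sum_range_succ]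
  push_cast
  field_simp
  ring

end Sequence

/-! ### Measurability of the statistics -/

section Measurability

/-- Projection along the compact simplex is a closed map, so a superlevel set at a level `c ≥ 0` is
a countable union of closed sets. An infeasible `w` has the default value `sSup ∅ = 0`, which does
not exceed such a `c`. -/
theorem measurable_empLik {m : ℕ} : Measurable (empLik : (Fin m → ℝ) → ℝ) := by
  refine measurable_of_Ioi fun c => ?_
  have hbdd : ∀ w : Fin m → ℝ, BddAbove {r : ℝ | ∃ p : Fin m → ℝ,
      (∀ i, 0 ≤ p i) ∧ ∑ i, p i = 1 ∧ ∑ i, p i * w i = 0 ∧ r = ∏ i, p i} := by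
    refine fun w => ⟨1, ?_⟩
    rintro r ⟨p, hp, hp1, -, rfl⟩
    refine Finset.prod_le_one (fun i _ => hp i) fun i _ => ?_
    rw [← hp1]
    exact Finset.single_le_sum (fun i _ => hp i) (Finset.mem_univ i)
  rcases lt_or_ge c 0 with hc | hc
  · convert MeasurableSet.univ
    rw [Set.eq_univ_iff_forall]
    refine fun w => hc.trans_le (Real.sSup_nonneg ?_)
    rintro r ⟨p, hp, -, -, rfl⟩
    exact Finset.prod_nonneg fun i _ => hp i
  · set E : ℕ → Set (stdSimplex ℝ (Fin m) × (Fin m → ℝ)) := fun k =>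
      {z | ∑ i, z.1.1 i * z.2 i = 0 ∧ c + 1 / ((k : ℝ) + 1) ≤ ∏ i, z.1.1 i} with hE
    have hEc : ∀ k, IsClosed (E k) := fun k => by
      have : E k = {z | ∑ i, z.1.1 i * z.2 i = 0} ∩
          {z | c + 1 / ((k : ℝ) + 1) ≤ ∏ i, z.1.1 i} := rfl
      have hc : ∀ i, Continuous fun z : stdSimplex ℝ (Fin m) × (Fin m → ℝ) => z.1.1 i :=
        fun i => (continuous_apply i).comp (continuous_subtype_val.comp continuous_fst)
      rw [this]
      exact (isClosed_eq (continuous_finsetSum _ fun i _ =>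
        (hc i).mul ((continuous_apply i).comp continuous_snd)) continuous_const).inter
        (isClosed_le continuous_const (continuous_finsetProd _ fun i _ => hc i))
    have hproj : ∀ k, IsClosed (Prod.snd '' E k) := fun k =>
      isClosedMap_snd_of_compactSpace _ (hEc k)
    have : empLik ⁻¹' Set.Ioi c = ⋃ k, Prod.snd '' E k := by
      ext w
      simp only [Set.mem_preimage, Set.mem_Ioi, Set.mem_iUnion, Set.mem_image]
      constructor
      · intro h
        have hne : {r : ℝ | ∃ p : Fin m → ℝ, (∀ i, 0 ≤ p i) ∧ ∑ i, p i = 1 ∧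
            ∑ i, p i * w i = 0 ∧ r = ∏ i, p i}.Nonempty := by
          by_contra h0
          rw [Set.not_nonempty_iff_eq_empty] at h0
          rw [empLik, h0, Real.sSup_empty] at h
          exact absurd h (not_lt.2 hc)
        obtain ⟨r, ⟨p, hp, hp1, hpw, rfl⟩, hr⟩ := exists_lt_of_lt_csSup hne h
        obtain ⟨k, hk⟩ := exists_nat_one_div_lt (sub_pos.2 hr)
        exact ⟨k, (⟨p, hp, hp1⟩, w), ⟨hpw, by linarith⟩, rfl⟩
      · rintro ⟨k, ⟨p, w'⟩, ⟨h1, h2⟩, rfl⟩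
        have hk : (0 : ℝ) < 1 / ((k : ℝ) + 1) := by positivity
        have h3 : c < ∏ i, p.1 i := lt_of_lt_of_le (lt_add_of_pos_right c hk) h2
        exact h3.trans_le (le_csSup (hbdd w') ⟨p.1, p.2.1, p.2.2, h1, rfl⟩)
    rw [this]
    exact MeasurableSet.iUnion fun k => (hproj k).measurableSet

theorem measurable_empCDF {n : ℕ} (y : ℝ) : Measurable fun x : Fin n → ℝ => empCDF x y := by
  rcases Nat.eq_zero_or_pos n with rfl | hn
  · simp [empCDF]
  have hn' : (n : ℝ) ≠ 0 := by exact_mod_cast hn.ne'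
  have : (fun x : Fin n → ℝ => empCDF x y) =
      fun x => (∑ i, (Set.Iic y).indicator (fun _ => (1 : ℝ)) (x i)) / n := by
    ext x
    rw [sum_indicator_one, mul_div_cancel_left₀ _ hn']
  rw [this]
  refine (Finset.measurable_fun_sum _ fun i _ => ?_).div_const _
  exact (measurable_const.indicator measurableSet_Iic).comp (measurable_pi_apply i)

theorem measurable_quantile_empCDF {n : ℕ} {t : ℝ} (ht0 : 0 < t) (ht1 : t ≤ 1) :
    Measurable fun x : Fin n → ℝ => quantile (empCDF x) t := by
  rcases Nat.eq_zero_or_pos n with rfl | hn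
  · exact Subsingleton.measurable
  refine measurable_of_Iic fun y => ?_
  have : (fun x : Fin n → ℝ => quantile (empCDF x) t) ⁻¹' Set.Iic y = {x | t ≤ empCDF x y} := by
    ext x
    exact quantile_empCDF_le_iff hn.ne' ht0 ht1 y
  rw [this]
  exact measurableSet_le measurable_const (measurable_empCDF y)

theorem measurable_score {n : ℕ} {t : ℝ} (ht0 : 0 < t) (ht1 : t ≤ 1) (θ : ℝ) (i : Fin n) :
    Measurable fun x : Fin n → ℝ => score x t θ i := by
  have : (fun x : Fin n → ℝ => score x t θ i) =
      fun x => (if x i ≤ quantile (empCDF x) t then x i else 0) - θ := by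
    ext x
    simp [score, trunc, Set.indicator_apply]
  rw [this]
  exact (Measurable.ite (measurableSet_le (measurable_pi_apply i)
    (measurable_quantile_empCDF ht0 ht1)) (measurable_pi_apply i) measurable_const).sub_const _

theorem measurable_ael {n : ℕ} {t : ℝ} (ht0 : 0 < t) (ht1 : t ≤ 1) (θ : ℝ) :
    Measurable fun x : Fin n → ℝ => ael x t θ := by
  have h : Measurable fun x : Fin n → ℝ => adjScore x t θ := by
    rw [measurable_pi_iff]
    intro i
    refine Fin.lastCases ?_ (fun j => ?_) i
    · simp only [adjScore, adjoinPseudo, Fin.snoc_last]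
      exact ((Finset.measurable_fun_sum _ fun i _ =>
        measurable_score ht0 ht1 θ i).const_mul _).const_mul _
    · simpa only [adjScore, adjoinPseudo, Fin.snoc_castSucc] using measurable_score ht0 ht1 θ j
  exact (((measurable_empLik.comp h).const_mul _).log).const_mul _

theorem measurable_tael {n : ℕ} {t : ℝ} (ht0 : 0 < t) (ht1 : t ≤ 1) (θ : ℝ) :
    Measurable fun x : Fin n → ℝ => tael x t θ := by
  have h := measurable_ael (n := n) ht0 ht1 θ
  exact h.mul (((h.div_const _).const_sub 1).max measurable_const)

end Measurability

/-! ### The population quantile and nondegeneracy -/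

section Population

variable {ν : Measure ℝ} {t : ℝ}

theorem popQuantile_le_of_le_cdf (ht0 : 0 < t) {x : ℝ} (hx : t ≤ cdf ν x) :
    popQuantile ν t ≤ x := by
  refine csInf_le ?_ hx
  obtain ⟨a, ha⟩ := ((tendsto_cdf_atBot ν).eventually_lt_const ht0).exists
  refine ⟨a, fun y hy => ?_⟩
  by_contra! h
  exact absurd (hy.trans (monotone_cdf ν h.le)) (not_le.2 ha)

theorem cdf_popQuantile [IsProbabilityMeasure ν] (ht0 : 0 < t)
    (hcont : ContinuousAt (fun y => cdf ν y) (popQuantile ν t))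
    (huniq : ∀ x, popQuantile ν t < x → t < cdf ν x) : cdf ν (popQuantile ν t) = t := by
  refine le_antisymm ?_ ?_
  · refine le_of_tendsto (hcont.tendsto.mono_left nhdsWithin_le_nhds :
      Tendsto _ (𝓝[<] (popQuantile ν t)) _) ?_
    filter_upwards [self_mem_nhdsWithin] with y (hy : y < _)
    by_contra! h
    exact absurd hy (not_lt.2 (popQuantile_le_of_le_cdf ht0 h.le))
  · refine ge_of_tendsto (hcont.tendsto.mono_left nhdsWithin_le_nhds :
      Tendsto _ (𝓝[>] (popQuantile ν t)) _) ?_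
    filter_upwards [self_mem_nhdsWithin] with y hy
    exact (huniq y hy).le

/-- A constant `c < ψ` would give `F c ≥ t`, against minimality of `ψ`; a constant `c ≥ ψ` would
leave no mass below any `y < ψ`, so `F ψ = 0` by continuity. Positivity of both variances rests on
this. -/
theorem not_ae_eq_const_below [IsProbabilityMeasure ν] (ht0 : 0 < t)
    (hcont : ContinuousAt (fun y => cdf ν y) (popQuantile ν t))
    (hψ : cdf ν (popQuantile ν t) = t) (c : ℝ) :
    ¬ ∀ᵐ x ∂ν, x ≤ popQuantile ν t → x = c := by
  intro h
  rcases lt_or_ge c (popQuantile ν t) with hc | hc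
  · have : t ≤ cdf ν c := by
      rw [← hψ, cdf_eq_real, cdf_eq_real]
      refine ENNReal.toReal_mono (measure_ne_top _ _) (measure_mono_ae ?_)
      filter_upwards [h] with x hx hxψ
      exact (hx hxψ).le
    exact absurd hc (not_lt.2 (popQuantile_le_of_le_cdf ht0 this))
  · have h0 : cdf ν (popQuantile ν t) ≤ 0 := by
      refine le_of_tendsto (hcont.tendsto.mono_left nhdsWithin_le_nhds :
        Tendsto _ (𝓝[<] (popQuantile ν t)) _) ?_
      filter_upwards [self_mem_nhdsWithin] with y (hy : y < _)
      have : ν (Set.Iic y) = 0 := by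
        rw [← compl_mem_ae_iff]
        filter_upwards [h] with x hx hxy
        have hxy' : x ≤ y := hxy
        have := hx (hxy'.trans hy.le)
        linarith
      rw [cdf_eq_real, measureReal_def, this, ENNReal.toReal_zero]
    linarith

theorem memLp_trunc (hsq : MemLp (fun x : ℝ => x) 2 ν) (ψ : ℝ) :
    MemLp (fun x => trunc ψ x) 2 ν := hsq.indicator measurableSet_Iic

theorem memLp_indicator_sub [IsProbabilityMeasure ν] (hsq : MemLp (fun x : ℝ => x) 2 ν) (ψ c : ℝ) :
    MemLp ((Set.Iic ψ).indicator (fun x => x - c)) 2 ν :=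
  (hsq.sub (memLp_const c)).indicator measurableSet_Iic

theorem exists_popQuantile_lt [IsProbabilityMeasure ν] (ht1 : t < 1) (hψ : cdf ν
    (popQuantile ν t) = t)
    {p : ℝ → Prop} (hp : ∀ᵐ x ∂ν, p x) : ∃ x, popQuantile ν t < x ∧ p x := by
  by_contra! h
  have : ν.real (Set.Iic (popQuantile ν t)) = 1 := by
    rw [measureReal_def, prob_compl_eq_zero_iff measurableSet_Iic |>.1, ENNReal.toReal_one]
    rw [← mem_ae_iff]
    filter_upwards [hp] with x hx
    by_contra hx'
    exact h x (not_le.1 hx') hx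
  rw [← cdf_eq_real, hψ] at this
  linarith

theorem sigmaPSq_pos [IsProbabilityMeasure ν] (hsq : MemLp (fun x : ℝ => x) 2 ν) (ht0 : 0 < t)
    (ht1 : t < 1)
    (hcont : ContinuousAt (fun y => cdf ν y) (popQuantile ν t))
    (hψ : cdf ν (popQuantile ν t) = t) : 0 < sigmaPSq ν t := by
  refine lt_of_le_of_ne (variance_nonneg _ _) fun h => ?_
  have hae := ae_eq_integral_of_variance_eq_zero (memLp_trunc hsq _) h.symm
  -- There is mass above the quantile, where the truncated variable is `0`; this identifies its
  -- almost sure constant value.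
  obtain ⟨x, hx, hxe⟩ := exists_popQuantile_lt ht1 hψ hae
  simp only [trunc, Set.indicator_apply, Set.mem_Iic, not_le.2 hx, if_false] at hxe
  refine not_ae_eq_const_below ht0 hcont hψ 0 ?_
  filter_upwards [hae] with y hy hyψ
  simp only [trunc, Set.indicator_apply, Set.mem_Iic] at hy
  rw [if_pos hyψ, ← hxe] at hy
  exact hy

theorem sigmaVSq_pos [IsProbabilityMeasure ν] (hsq : MemLp (fun x : ℝ => x) 2 ν) (ht0 : 0 < t)
    (ht1 : t < 1)
    (hcont : ContinuousAt (fun y => cdf ν y) (popQuantile ν t))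
    (hψ : cdf ν (popQuantile ν t) = t) : 0 < sigmaVSq ν t := by
  refine lt_of_le_of_ne (variance_nonneg _ _) fun h => ?_
  have hae := ae_eq_integral_of_variance_eq_zero (memLp_indicator_sub hsq _ _) h.symm
  obtain ⟨x, hx, hxe⟩ := exists_popQuantile_lt ht1 hψ hae
  rw [Set.indicator_of_notMem (by simpa using hx)] at hxe
  refine not_ae_eq_const_below ht0 hcont hψ (popQuantile ν t) ?_
  filter_upwards [hae] with y hy hyψ
  rw [Set.indicator_of_mem (by simpa using hyψ), ← hxe] at hy
  linarith

theorem measure_singleton_eq_zero [IsProbabilityMeasure ν] {x : ℝ} (h : ContinuousAt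
    (fun y => cdf ν y) x) :
    ν {x} = 0 := by
  rw [← measure_cdf ν, StieltjesFunction.measure_singleton,
    leftLim_eq_of_tendsto (h.tendsto.mono_left nhdsWithin_le_nhds)]
  simp

/-- By Fubini, the diagonal over a set without atoms is null for the product law. -/
theorem ae_ne_of_indepFun [IsProbabilityMeasure ν] {Ω : Type*} [MeasurableSpace Ω]
    {P : Measure Ω} [IsProbabilityMeasure P]
    {X Y : Ω → ℝ} (hX : HasLaw X ν P) (hY : HasLaw Y ν P) (hXY : IndepFun X Y P) {U : Set ℝ}
    (hU : MeasurableSet U) (hUν : ∀ x ∈ U, ν {x} = 0) :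
    ∀ᵐ ω ∂P, X ω ∈ U → X ω ≠ Y ω := by
  have hlaw := hXY.hasLaw_prod hX hY
  have hmeas : MeasurableSet {z : ℝ × ℝ | z.1 ∈ U ∧ z.1 = z.2} :=
    (measurable_fst hU).inter (measurableSet_eq_fun measurable_fst measurable_snd)
  have h0 : (ν.prod ν) {z : ℝ × ℝ | z.1 ∈ U ∧ z.1 = z.2} = 0 := by
    rw [Measure.measure_prod_null hmeas]
    refine ae_of_all _ fun x => ?_
    by_cases hx : x ∈ U
    · refine measure_mono_null ?_ (hUν x hx)
      rintro y ⟨-, hy : x = y⟩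
      exact hy.symm
    · refine measure_mono_null ?_ (measure_empty (μ := ν))
      rintro y ⟨hy, -⟩
      exact hx hy
  have h1 := hlaw.measure_eq (p := fun z => z.1 ∈ U ∧ z.1 = z.2) hmeas
  rw [h0] at h1
  rw [ae_iff]
  simpa using h1

end Population

/-- A sequence that tends to zero almost surely along the indices where a tight sequence stays
bounded tends to zero in probability. -/
theorem tendstoInMeasure_zero_of_tight {Ω Ω' : Type*} [MeasurableSpace Ω] [MeasurableSpace Ω']
    {P : Measure Ω} [IsProbabilityMeasure P] {Q : Measure Ω'} [IsProbabilityMeasure Q]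
    {T D : ℕ → Ω → ℝ} {Z : Ω' → ℝ} (hT : TendstoInDistribution T atTop Z (fun _ => P) Q)
    (hD : ∀ n, AEMeasurable (D n) P)
    (h : ∀ᵐ ω ∂P, ∀ M : ℕ, Tendsto (fun n => D n ω)
      (atTop ⊓ 𝓟 {n | |T n ω| ≤ M}) (𝓝 0)) : TendstoInMeasure P D atTop 0 := by
  rw [tendstoInMeasure_iff_norm]
  intro ε hε
  rw [ENNReal.tendsto_nhds_zero]
  intro δ hδ
  have : IsProbabilityMeasure (Q.map Z) := Measure.isProbabilityMeasure_map hT.aemeasurable_limit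
  set F : ℕ → Set ℝ := fun M => {z | (M : ℝ) ≤ |z|} with hF
  have hFc : ∀ M, IsClosed (F M) := fun M => isClosed_le continuous_const continuous_abs
  have hFt : Tendsto (fun M => (Q.map Z) (F M)) atTop (𝓝 0) := by
    have h1 := tendsto_measure_iInter_atTop (μ := Q.map Z) (s := F)
      (fun M => (hFc M).measurableSet.nullMeasurableSet)
      (fun a b hab z (hz : (b : ℝ) ≤ |z|) => le_trans (by exact_mod_cast hab) hz)
      ⟨0, measure_ne_top _ _⟩
    have h2 : ⋂ M, F M = ∅ := by
      rw [Set.eq_empty_iff_forall_notMem]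
      intro z hz
      obtain ⟨k, hk⟩ := exists_nat_gt |z|
      exact absurd (Set.mem_iInter.1 hz k) (not_le.2 hk)
    rwa [h2, measure_empty] at h1
  -- `M` makes the limit's tail less than `δ / 2`; the portmanteau theorem for the closed set `F M`
  -- carries this to `T n`.
  obtain ⟨M, hM⟩ := (hFt.eventually_lt_const (ENNReal.half_pos hδ.ne')).exists
  have hlim := ProbabilityMeasure.limsup_measure_closed_le_of_tendsto hT.tendsto (hFc M)
  have hev := eventually_lt_of_limsup_lt (hlim.trans_lt hM)
  have hTm := hT.forall_aemeasurable
  set D' : ℕ → Ω → ℝ := fun n => {ω | |T n ω| ≤ M}.indicator (D n) with hD'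
  have hD'm : ∀ n, AEMeasurable (D' n) P := fun n =>
    (hD n).indicator₀ (nullMeasurableSet_le (hTm n).abs aemeasurable_const)
  have hD't : TendstoInMeasure P D' atTop (fun _ => 0) := by
    refine tendstoInMeasure_of_tendsto_ae (fun n => (hD'm n).aestronglyMeasurable) ?_
    filter_upwards [h] with ω hω
    have h1 := Metric.tendsto_nhds.1 (hω M)
    rw [Metric.tendsto_nhds]
    intro η hη
    filter_upwards [eventually_inf_principal.1 (h1 η hη)] with n hn
    by_cases hc : |T n ω| ≤ M
    · simpa [hD', Set.indicator_apply, hc] using hn hc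
    · simpa [hD', Set.indicator_apply, hc] using hη
  have hD'' := ENNReal.tendsto_nhds_zero.1 (tendstoInMeasure_iff_norm.1 hD't ε hε) (δ / 2)
    (ENNReal.half_pos hδ.ne')
  filter_upwards [hev, hD''] with n h1 h2
  have h1' : P {ω | (M : ℝ) ≤ |T n ω|} < δ / 2 := by
    have := Measure.map_apply_of_aemeasurable (hTm n) (hFc M).measurableSet
    exact this ▸ h1
  calc P {ω | ε ≤ ‖D n ω - (0 : Ω → ℝ) ω‖}
      ≤ P ({ω | (M : ℝ) ≤ |T n ω|} ∪ {ω | ε ≤ ‖D' n ω - 0‖}) := by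
        refine measure_mono fun ω hω => ?_
        rcases le_or_gt |T n ω| M with hc | hc
        · right
          simpa [hD', Set.indicator_apply, hc] using hω
        · exact Or.inl hc.le
    _ ≤ δ / 2 + δ / 2 := (measure_union_le _ _).trans (add_le_add h1'.le h2)
    _ = δ := ENNReal.add_halves δ

/-! ### Estimated scores along one sample path -/

section Path

variable {x : ℕ → ℝ} {t ψ θ : ℝ}

/-- The sample `t`-quantile of the first `n` terms of a sequence. -/
noncomputable def sampleQuantile (x : ℕ → ℝ) (t : ℝ) (n : ℕ) : ℝ :=
  quantile (empCDF (fun i : Fin n => x i)) t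

theorem eventually_empCDF_sampleQuantile (ht0 : 0 < t) (ht1 : t ≤ 1)
    (hq : Tendsto (sampleQuantile x t) atTop (𝓝 ψ)) {U : Set ℝ} (hU : U ∈ 𝓝 ψ)
    (hties : ∀ i j, x i ∈ U → x i = x j → i = j) :
    ∀ᶠ n : ℕ in atTop, |n * empCDF (fun i : Fin n => x i) (sampleQuantile x t n) - n * t| ≤ 1 := by
  filter_upwards [hq.eventually_mem hU, eventually_ne_atTop 0] with n hn hn0
  have h1 := mul_le_mul_of_nonneg_left
    (le_empCDF_quantile (x := fun i : Fin n => x i) hn0 ht1) (Nat.cast_nonneg (α := ℝ) n)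
  have h2 := empCDF_quantile_le (x := fun i : Fin n => x i) hn0 ht0 ht1 fun i j hi hj =>
    Fin.ext (hties i j (hi ▸ hn) (hi.trans hj.symm))
  rw [abs_le]
  unfold sampleQuantile
  constructor <;> linarith

theorem tendsto_empCDF_sampleQuantile
    (hcount : ∀ᶠ n : ℕ in atTop,
      |n * empCDF (fun i : Fin n => x i) (sampleQuantile x t n) - n * t| ≤ 1) :
    Tendsto (fun n => empCDF (fun i : Fin n => x i) (sampleQuantile x t n)) atTop (𝓝 t) := by
  rw [← tendsto_sub_nhds_zero_iff]
  refine squeeze_zero_norm' ?_ (tendsto_inv_atTop_nhds_zero_nat (𝕜 := ℝ))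
  filter_upwards [hcount, eventually_gt_atTop 0] with n hn h0
  have h0' : (0 : ℝ) < n := by exact_mod_cast h0
  rw [← mul_sub, abs_mul, abs_of_pos h0'] at hn
  rwa [Real.norm_eq_abs, inv_eq_one_div, le_div_iff₀' h0']

/-- Only `o(n)` observations lie between the two truncation points, and `g` is bounded near `ψ`. -/
theorem tendsto_mean_indicator_sub
    (hq : Tendsto (sampleQuantile x t) atTop (𝓝 ψ))
    (hF : Tendsto (fun n => empCDF (fun i : Fin n => x i) ψ) atTop (𝓝 t))
    (hFq : Tendsto (fun n => empCDF (fun i : Fin n => x i) (sampleQuantile x t n)) atTop (𝓝 t))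
    {g : ℝ → ℝ} (hg : Continuous g) :
    Tendsto (fun n : ℕ => (∑ i : Fin n, (Set.Iic (sampleQuantile x t n)).indicator g (x i) -
      ∑ i : Fin n, (Set.Iic ψ).indicator g (x i)) / n) atTop (𝓝 0) := by
  obtain ⟨C, hC⟩ := (isCompact_closedBall ψ 1).exists_bound_of_continuousOn hg.continuousOn
  have h1 := ((hFq.sub hF).abs).const_mul C
  rw [sub_self, abs_zero, mul_zero] at h1
  refine squeeze_zero_norm' ?_ h1
  filter_upwards [hq.eventually_mem (Metric.closedBall_mem_nhds ψ one_pos),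
    eventually_gt_atTop 0] with n hn h0
  have h0' : (0 : ℝ) < n := by exact_mod_cast h0
  have h2 := abs_sum_indicator_sub_le (x := fun i : Fin n => x i) g
    (a := sampleQuantile x t n) (b := ψ) (C := C) fun y hy => by
      refine hC y ?_
      rw [Metric.mem_closedBall, Real.dist_eq] at hn ⊢
      rw [abs_sub_comm] at hn ⊢
      exact (Set.abs_sub_right_of_mem_uIcc (Set.uIoc_subset_uIcc hy)).trans hn
  rw [← mul_sub, abs_mul, abs_of_pos h0'] at h2
  rw [Real.norm_eq_abs, abs_div, abs_of_pos h0', div_le_iff₀ h0']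
  linarith

theorem tendsto_mean_sq_score
    (hq : Tendsto (sampleQuantile x t) atTop (𝓝 ψ))
    (hF : Tendsto (fun n => empCDF (fun i : Fin n => x i) ψ) atTop (𝓝 t))
    (hFq : Tendsto (fun n => empCDF (fun i : Fin n => x i) (sampleQuantile x t n)) atTop (𝓝 t))
    {s : ℝ}
    (h1 : Tendsto (fun n : ℕ => (∑ i : Fin n, (Set.Iic ψ).indicator (fun y => y) (x i)) / n)
      atTop (𝓝 θ))
    (h2 : Tendsto (fun n : ℕ => (∑ i : Fin n, (Set.Iic ψ).indicator (fun y => y ^ 2) (x i)) / n)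
      atTop (𝓝 s)) :
    Tendsto (fun n : ℕ => (∑ i, score (fun i : Fin n => x i) t θ i ^ 2) / n) atTop
      (𝓝 (s - θ ^ 2)) := by
  have e1 := (tendsto_mean_indicator_sub hq hF hFq (g := fun y => y) continuous_id).add h1
  have e2 := (tendsto_mean_indicator_sub hq hF hFq (continuous_pow 2)).add h2
  have e3 := (e2.sub (e1.const_mul (2 * θ))).add_const (θ ^ 2)
  have hlim : 0 + s - 2 * θ * (0 + θ) + θ ^ 2 = s - θ ^ 2 := by ring
  rw [hlim] at e3
  refine e3.congr' ?_
  filter_upwards [eventually_gt_atTop 0] with n h0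
  have h0' : (n : ℝ) ≠ 0 := by exact_mod_cast h0.ne'
  have hterm : ∀ i : Fin n, score (fun i : Fin n => x i) t θ i ^ 2 =
      (Set.Iic (sampleQuantile x t n)).indicator (fun y => y ^ 2) (x i) -
        2 * θ * (Set.Iic (sampleQuantile x t n)).indicator (fun y => y) (x i) + θ ^ 2 := fun i => by
    simp only [score, trunc, sampleQuantile, Set.indicator_apply, Set.mem_Iic]
    split_ifs <;> ring
  simp only [hterm, Finset.sum_add_distrib, Finset.sum_sub_distrib, ← Finset.mul_sum,
    Finset.sum_const, Finset.card_univ, Fintype.card_fin, nsmul_eq_mul]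
  field_simp
  ring

/-- Linearization of the estimated scores: estimating the quantile replaces the truncated variable
by the truncated excess over the quantile. -/
theorem tendsto_score_sub_linearization
    (hq : Tendsto (sampleQuantile x t) atTop (𝓝 ψ))
    (hcount : ∀ᶠ n : ℕ in atTop,
      |n * empCDF (fun i : Fin n => x i) (sampleQuantile x t n) - n * t| ≤ 1) (M : ℝ) :
    Tendsto (fun n : ℕ => (∑ i, score (fun i : Fin n => x i) t θ i) / √n -
        (√n)⁻¹ * (∑ i : Fin n, (Set.Iic ψ).indicator (fun y => y - ψ) (x i) - n * (θ - ψ * t)))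
      (atTop ⊓ 𝓟 {n : ℕ | |(√n)⁻¹ * (n * empCDF (fun i : Fin n => x i) ψ - n * t)| ≤ M})
      (𝓝 0) := by
  set l : Filter ℕ :=
    atTop ⊓ 𝓟 {n : ℕ | |(√n)⁻¹ * (n * empCDF (fun i : Fin n => x i) ψ - n * t)| ≤ M} with hl
  have hle : l ≤ atTop := inf_le_left
  have hU : ∀ᶠ n : ℕ in l, |(√n)⁻¹ * (n * empCDF (fun i : Fin n => x i) ψ - n * t)| ≤ M :=
    mem_inf_of_right (mem_principal_self _)
  have hs : Tendsto (fun n : ℕ => (√(n : ℝ))⁻¹) atTop (𝓝 0) :=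
    tendsto_inv_atTop_zero.comp (Real.tendsto_sqrt_atTop.comp tendsto_natCast_atTop_atTop)
  have hq0 : Tendsto (fun n => |sampleQuantile x t n - ψ|) atTop (𝓝 0) := by
    simpa using (hq.sub_const ψ).abs
  have hb := ((hq0.mul (hs.add_const M)).add (hs.const_mul |ψ|)).mono_left hle
  simp only [zero_mul, mul_zero, zero_add] at hb
  refine squeeze_zero_norm' ?_ hb
  filter_upwards [hU, hle hcount, hle (eventually_gt_atTop 0)] with n h1 h2 h0
  have h0' : (0 : ℝ) < n := by exact_mod_cast h0
  have hr : 0 < √(n : ℝ) := Real.sqrt_pos.2 h0'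
  set q := sampleQuantile x t n with hqdef
  set N := (n : ℝ) * empCDF (fun i : Fin n => x i) q with hN
  set N₀ := (n : ℝ) * empCDF (fun i : Fin n => x i) ψ with hN₀
  have hsplit : ∑ i, score (fun i : Fin n => x i) t θ i =
      ∑ i : Fin n, (Set.Iic q).indicator (fun y => y - ψ) (x i) + ψ * N - n * θ := by
    rw [hN, ← sum_indicator_one, Finset.mul_sum, ← Finset.sum_add_distrib]
    simp only [score, Finset.sum_sub_distrib, Finset.sum_const, Finset.card_univ, Fintype.card_fin,
      nsmul_eq_mul]
    congr 1
    refine Finset.sum_congr rfl fun i _ => ?_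
    simp only [trunc, hqdef, sampleQuantile, Set.indicator_apply]
    split_ifs <;> ring
  -- The centred summand vanishes at `ψ`, so each crossed observation costs at most `|q - ψ|`, which
  -- tends to zero.
  have h3 := abs_sum_indicator_sub_le (x := fun i : Fin n => x i) (fun y => y - ψ)
    (a := q) (b := ψ) (C := |q - ψ|) fun y hy => by
      rw [abs_sub_comm y, abs_sub_comm q]
      exact Set.abs_sub_right_of_mem_uIcc (Set.uIoc_subset_uIcc hy)
  have h4 : |N₀ - n * t| ≤ M * √n := by
    rw [abs_mul, abs_of_pos (inv_pos.2 hr), inv_mul_le_iff₀ hr] at h1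
    linarith
  have h5 : |N - N₀| ≤ 1 + M * √n := by
    have : N - N₀ = (N - n * t) - (N₀ - n * t) := by ring
    rw [this]
    exact (abs_sub _ _).trans (add_le_add h2 h4)
  have h6 : (∑ i, score (fun i : Fin n => x i) t θ i) / √n -
      (√n)⁻¹ * (∑ i : Fin n, (Set.Iic ψ).indicator (fun y => y - ψ) (x i) - n * (θ - ψ * t)) =
      (√n)⁻¹ * ((∑ i : Fin n, (Set.Iic q).indicator (fun y => y - ψ) (x i) -
        ∑ i : Fin n, (Set.Iic ψ).indicator (fun y => y - ψ) (x i)) + ψ * (N - n * t)) := by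
    rw [hsplit]; ring
  rw [h6, Real.norm_eq_abs, abs_mul, abs_of_pos (inv_pos.2 hr), inv_mul_le_iff₀ hr]
  calc _ ≤ |q - ψ| * (1 + M * √n) + |ψ| * 1 := by
        refine (abs_add_le _ _).trans (add_le_add (h3.trans ?_) ?_)
        · exact mul_le_mul_of_nonneg_left h5 (abs_nonneg _)
        · rw [abs_mul]
          exact mul_le_mul_of_nonneg_left h2 (abs_nonneg _)
    _ = _ := by field_simp

theorem eventually_abs_score_le (hx : Tendsto (fun n : ℕ => x n ^ 2 / n) atTop (𝓝 0))
    {z : ℝ} (hz : 0 < z) :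
    ∀ᶠ n : ℕ in atTop, ∀ i, |score (fun i : Fin n => x i) t θ i| ≤ z * √n := by
  have h1 : Tendsto (fun n : ℕ => z / 2 * √(n : ℝ)) atTop atTop :=
    (Real.tendsto_sqrt_atTop.comp tendsto_natCast_atTop_atTop).const_mul_atTop (half_pos hz)
  filter_upwards [eventually_abs_le_mul_sqrt hx (half_pos hz), h1.eventually_ge_atTop |θ|]
    with n h2 h3 i
  have h4 : |trunc (quantile (empCDF (fun i : Fin n => x i)) t) (x i)| ≤ |x i| := by
    simp only [trunc, Set.indicator_apply]
    split_ifs <;> simp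
  have h5 := h2 i i.2
  calc _ ≤ |trunc (quantile (empCDF (fun i : Fin n => x i)) t) (x i)| + |θ| := abs_sub _ _
    _ ≤ z * √n := by linarith

end Path

/-! ### Strong law and central limit theorem for functions of the sample -/

section LimitTheorems

variable {Ω : Type*} [MeasurableSpace Ω] {P : Measure Ω} {ν : Measure ℝ} {X : ℕ → Ω → ℝ}

theorem ae_tendsto_mean_comp (hlaw : ∀ i, HasLaw (X i) ν P) (hindep : iIndepFun X P) {f : ℝ → ℝ}
    (hf : Measurable f) (hfi : Integrable f ν) :
    ∀ᵐ ω ∂P, Tendsto (fun n : ℕ => (∑ i : Fin n, f (X i ω)) / n) atTop (𝓝 (∫ x, f x ∂ν)) := by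
  have hid : ∀ i, IdentDistrib (X i) (X 0) P P := fun i =>
    ⟨(hlaw i).aemeasurable, (hlaw 0).aemeasurable, by rw [(hlaw i).map_eq, (hlaw 0).map_eq]⟩
  have hint : Integrable (f ∘ X 0) P := by
    have := (hlaw 0).map_eq ▸ hfi
    exact this.comp_aemeasurable (hlaw 0).aemeasurable
  have h := strong_law_ae_real (fun i => f ∘ X i) hint
    (fun i j hij => (hindep.indepFun hij).comp hf hf) (fun i => (hid i).comp hf)
  have he : ∫ ω, (f ∘ X 0) ω ∂P = ∫ x, f x ∂ν :=
    (hlaw 0).integral_comp hfi.aestronglyMeasurable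
  rw [he] at h
  filter_upwards [h] with ω hω
  refine hω.congr fun n => ?_
  rw [Fin.sum_univ_eq_sum_range (fun i => f (X i ω))]
  rfl

theorem tendstoInDistribution_comp [IsProbabilityMeasure P] (hlaw : ∀ i, HasLaw (X i) ν P)
    (hindep : iIndepFun X P)
    {f : ℝ → ℝ} (hf : Measurable f) (hf2 : MemLp f 2 ν) :
    TendstoInDistribution (fun (n : ℕ) ω => (√n)⁻¹ * (∑ i : Fin n, f (X i ω) - n * ∫ x, f x ∂ν))
      atTop (fun z => √(variance f ν) * z) (fun _ => P) (gaussianReal 0 1) := by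
  have hid : ∀ i, IdentDistrib (X i) (X 0) P P := fun i =>
    ⟨(hlaw i).aemeasurable, (hlaw 0).aemeasurable, by rw [(hlaw i).map_eq, (hlaw 0).map_eq]⟩
  have hmem : MemLp (f ∘ X 0) 2 P := by
    have := (hlaw 0).map_eq ▸ hf2
    exact this.comp_of_map (hlaw 0).aemeasurable
  have he : ∫ ω, (f ∘ X 0) ω ∂P = ∫ x, f x ∂ν :=
    (hlaw 0).integral_comp hf2.aestronglyMeasurable
  have hv : variance (f ∘ X 0) P = variance f ν := by
    rw [← (hlaw 0).map_eq, variance_map (by rw [(hlaw 0).map_eq]; exact hf.aemeasurable)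
      (hlaw 0).aemeasurable]
  have hY : HasLaw (fun z : ℝ => √(variance f ν) * z)
      (gaussianReal 0 (variance (f ∘ X 0) P).toNNReal) (gaussianReal 0 1) := by
    refine ⟨by fun_prop, ?_⟩
    rw [gaussianReal_map_const_mul, mul_zero, mul_one, hv]
    congr 1
    ext
    simp [Real.sq_sqrt (variance_nonneg f ν), variance_nonneg]
  have h := tendstoInDistribution_inv_sqrt_mul_sum_sub (X := fun i => f ∘ X i) hY hmem
    (hindep.comp (fun _ => f) (fun _ => hf)) (fun i => (hid i).comp hf)
  rw [he] at h
  convert h using 5 with n ω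
  exact Fin.sum_univ_eq_sum_range (fun i => f (X i ω)) n

end LimitTheorems

/-! ### Probabilistic assembly -/

section Main

variable {Ω : Type*} [MeasurableSpace Ω] {P : Measure Ω} {ν : Measure ℝ} {X : ℕ → Ω → ℝ} {t : ℝ}

theorem integral_indicator_Iic_one [IsProbabilityMeasure ν] (y : ℝ) :
    ∫ x, (Set.Iic y).indicator (fun _ => (1 : ℝ)) x ∂ν = cdf ν y := by
  rw [integral_indicator measurableSet_Iic, cdf_eq_real]
  simp

theorem ae_tendsto_empCDF [IsProbabilityMeasure ν] (hlaw : ∀ i, HasLaw (X i) ν P)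
    (hindep : iIndepFun X P) (y : ℝ) :
    ∀ᵐ ω ∂P, Tendsto (fun n => empCDF (fun i : Fin n => X i ω) y) atTop (𝓝 (cdf ν y)) := by
  have h := ae_tendsto_mean_comp hlaw hindep (f := (Set.Iic y).indicator (fun _ => (1 : ℝ)))
    (measurable_const.indicator measurableSet_Iic)
    ((integrable_const (1 : ℝ)).indicator measurableSet_Iic)
  filter_upwards [h] with ω hω
  rw [integral_indicator_Iic_one] at hω
  refine hω.congr' ?_
  filter_upwards [eventually_ne_atTop 0] with n hn
  rw [sum_indicator_one (fun i : Fin n => X i ω), mul_div_cancel_left₀ _ (Nat.cast_ne_zero.2 hn)]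

theorem ae_tendsto_sq_div (hlaw : ∀ i, HasLaw (X i) ν P) (hindep : iIndepFun X P)
    (hsq : MemLp (fun x : ℝ => x) 2 ν) :
    ∀ᵐ ω ∂P, Tendsto (fun n : ℕ => X n ω ^ 2 / n) atTop (𝓝 0) := by
  filter_upwards [ae_tendsto_mean_comp hlaw hindep (f := fun x => x ^ 2) (by fun_prop)
    hsq.integrable_sq] with ω hω
  refine tendsto_sq_div_of_tendsto_mean (y := fun n => X n ω ^ 2) (hω.congr fun n => ?_)
  rw [Fin.sum_univ_eq_sum_range (fun i => X i ω ^ 2)]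

theorem ae_tendsto_sampleQuantile [IsProbabilityMeasure ν] (hlaw : ∀ i, HasLaw (X i) ν P)
    (hindep : iIndepFun X P)
    (ht0 : 0 < t) (ht1 : t ≤ 1) (huniq : ∀ x, popQuantile ν t < x → t < cdf ν x) :
    ∀ᵐ ω ∂P, Tendsto (sampleQuantile (fun i => X i ω) t) atTop (𝓝 (popQuantile ν t)) := by
  have hlow := ae_all_iff.2 fun k : ℕ =>
    ae_tendsto_empCDF hlaw hindep (popQuantile ν t - 1 / ((k : ℝ) + 1))
  have hup := ae_all_iff.2 fun k : ℕ =>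
    ae_tendsto_empCDF hlaw hindep (popQuantile ν t + 1 / ((k : ℝ) + 1))
  filter_upwards [hlow, hup] with ω h1 h2
  refine tendsto_quantile_empCDF (x := fun i => X i ω) ht0 ht1
    (fun k => ⟨_, ?_, h1 k⟩) (fun k => ⟨_, huniq _ ?_, h2 k⟩)
  · have hk : (0 : ℝ) < 1 / ((k : ℝ) + 1) := by positivity
    by_contra! h
    linarith [popQuantile_le_of_le_cdf ht0 h]
  · have hk : (0 : ℝ) < 1 / ((k : ℝ) + 1) := by positivity
    linarith

theorem ae_eventually_empCDF_sampleQuantile [IsProbabilityMeasure P] [IsProbabilityMeasure ν]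
    (hlaw : ∀ i, HasLaw (X i) ν P)
    (hindep : iIndepFun X P) (ht0 : 0 < t) (ht1 : t ≤ 1)
    (hcont : ∀ᶠ x in 𝓝 (popQuantile ν t), ContinuousAt (fun y => cdf ν y) x)
    (huniq : ∀ x, popQuantile ν t < x → t < cdf ν x) :
    ∀ᵐ ω ∂P, ∀ᶠ n : ℕ in atTop, |n * empCDF (fun i : Fin n => X i ω)
      (sampleQuantile (fun i => X i ω) t n) - n * t| ≤ 1 := by
  obtain ⟨U, hUcont, hUo, hψU⟩ := eventually_nhds_iff.1 hcont
  -- Ties are excluded only in `U`, where the law has no atoms; the sample quantile eventually lies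
  -- there.
  have hties : ∀ᵐ ω ∂P, ∀ i j, i ≠ j → X i ω ∈ U → X i ω ≠ X j ω := by
    simp only [ae_all_iff]
    exact fun i j hij => ae_ne_of_indepFun (hlaw i) (hlaw j) (hindep.indepFun hij)
      hUo.measurableSet fun x hx => measure_singleton_eq_zero (hUcont x hx)
  filter_upwards [ae_tendsto_sampleQuantile hlaw hindep ht0 ht1 huniq, hties] with ω h1 h2
  refine eventually_empCDF_sampleQuantile (x := fun i => X i ω) ht0 ht1 h1
    (hUo.mem_nhds hψU) fun i j hi hij => ?_
  by_contra hne
  exact h2 i j hne hi hij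

theorem aemeasurable_comp_sample (hlaw : ∀ i, HasLaw (X i) ν P) {n : ℕ} {f : (Fin n → ℝ) → ℝ}
    (hf : Measurable f) : AEMeasurable (fun ω => f (fun i : Fin n => X i ω)) P :=
  hf.comp_aemeasurable (aemeasurable_pi_lambda _ fun i => (hlaw i).aemeasurable)

theorem integral_trunc_excess [IsProbabilityMeasure ν] (hsq : MemLp (fun x : ℝ => x) 2 ν)
    (hψ : cdf ν (popQuantile ν t) = t) :
    ∫ x, (Set.Iic (popQuantile ν t)).indicator (fun y => y - popQuantile ν t) x ∂ν =
      lorenz ν t - popQuantile ν t * t := by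
  set ψ := popQuantile ν t
  have h1 : ∀ x, (Set.Iic ψ).indicator (fun y => y - ψ) x =
      trunc ψ x - ψ * (Set.Iic ψ).indicator (fun _ => (1 : ℝ)) x := fun x => by
    simp only [trunc, Set.indicator_apply]
    split_ifs <;> ring
  simp only [h1]
  rw [integral_sub ((memLp_trunc hsq ψ).integrable one_le_two)
    (((integrable_const (1 : ℝ)).indicator measurableSet_Iic).const_mul _), integral_const_mul,
    integral_indicator_Iic_one, hψ]
  rfl

/-- The root-`n` normalized sum of the estimated scores is asymptotically normal with variance
`σ_v²`. -/
theorem tendstoInDistribution_score [IsProbabilityMeasure P] [IsProbabilityMeasure ν]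
    (hlaw : ∀ i, HasLaw (X i) ν P) (hindep : iIndepFun X P)
    (hsq : MemLp (fun x : ℝ => x) 2 ν) (ht0 : 0 < t) (ht1 : t ≤ 1)
    (hcont : ∀ᶠ x in 𝓝 (popQuantile ν t), ContinuousAt (fun y => cdf ν y) x)
    (huniq : ∀ x, popQuantile ν t < x → t < cdf ν x) :
    TendstoInDistribution
      (fun (n : ℕ) ω => (∑ i, score (fun i : Fin n => X i ω) t (lorenz ν t) i) / √n)
      atTop (fun z => √(sigmaVSq ν t) * z) (fun _ => P) (gaussianReal 0 1) := by
  have hψ := cdf_popQuantile ht0 hcont.self_of_nhds huniq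
  have hV := tendstoInDistribution_comp hlaw hindep
    ((measurable_id.sub_const (popQuantile ν t)).indicator measurableSet_Iic)
    (memLp_indicator_sub hsq (popQuantile ν t) (popQuantile ν t))
  have hU := tendstoInDistribution_comp hlaw hindep
    (f := (Set.Iic (popQuantile ν t)).indicator (fun _ => (1 : ℝ)))
    (measurable_const.indicator measurableSet_Iic)
    ((memLp_const (1 : ℝ)).indicator measurableSet_Iic)
  simp only [id] at hV
  rw [integral_trunc_excess hsq hψ] at hV
  rw [integral_indicator_Iic_one, hψ] at hU
  have hT : ∀ n : ℕ, AEMeasurable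
      (fun ω => (∑ i, score (fun i : Fin n => X i ω) t (lorenz ν t) i) / √n) P := fun n =>
    aemeasurable_comp_sample hlaw ((Finset.measurable_fun_sum _ fun i _ =>
      measurable_score ht0 ht1 (lorenz ν t) i).div_const _)
  refine tendstoInDistribution_of_tendstoInMeasure_sub _ _ hV ?_ hT
  -- The tight sequence here is the normalized count of observations below `ψ`.
  refine tendstoInMeasure_zero_of_tight hU
    (fun n => (hT n).sub (hV.forall_aemeasurable n)) ?_
  filter_upwards [ae_tendsto_sampleQuantile hlaw hindep ht0 ht1 huniq,
    ae_eventually_empCDF_sampleQuantile hlaw hindep ht0 ht1 hcont huniq] with ω h1 h2 M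
  have h3 := tendsto_score_sub_linearization (θ := lorenz ν t) h1 h2 M
  simp only [← sum_indicator_one] at h3
  exact h3

theorem ae_tendsto_mean_sq_score [IsProbabilityMeasure P] [IsProbabilityMeasure ν]
    (hlaw : ∀ i, HasLaw (X i) ν P) (hindep : iIndepFun X P)
    (hsq : MemLp (fun x : ℝ => x) 2 ν) (ht0 : 0 < t) (ht1 : t ≤ 1)
    (hcont : ∀ᶠ x in 𝓝 (popQuantile ν t), ContinuousAt (fun y => cdf ν y) x)
    (huniq : ∀ x, popQuantile ν t < x → t < cdf ν x) :
    ∀ᵐ ω ∂P, Tendsto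
      (fun n : ℕ => (∑ i, score (fun i : Fin n => X i ω) t (lorenz ν t) i ^ 2) / n) atTop
      (𝓝 (sigmaPSq ν t)) := by
  have hψ := cdf_popQuantile ht0 hcont.self_of_nhds huniq
  set ψ := popQuantile ν t with hψdef
  have hvar : sigmaPSq ν t =
      ∫ x, (Set.Iic ψ).indicator (fun y => y ^ 2) x ∂ν - lorenz ν t ^ 2 := by
    rw [sigmaPSq, variance_eq_sub (memLp_trunc hsq _)]
    congr 1
    refine integral_congr_ae (ae_of_all _ fun x => ?_)
    simp only [Pi.pow_apply, trunc, Set.indicator_apply]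
    split_ifs <;> simp
  rw [hvar]
  filter_upwards [ae_tendsto_sampleQuantile hlaw hindep ht0 ht1 huniq,
    ae_eventually_empCDF_sampleQuantile hlaw hindep ht0 ht1 hcont huniq,
    ae_tendsto_empCDF hlaw hindep ψ,
    ae_tendsto_mean_comp hlaw hindep (measurable_id.indicator measurableSet_Iic)
      ((memLp_trunc hsq ψ).integrable one_le_two),
    ae_tendsto_mean_comp hlaw hindep ((measurable_id.pow_const 2).indicator measurableSet_Iic)
      (hsq.integrable_sq.indicator (measurableSet_Iic (a := ψ)))] with ω h1 h2 h3 h4 h5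
  rw [hψ] at h3
  have h6 : Tendsto (fun n => empCDF (fun i : Fin n => X i ω)
      (sampleQuantile (fun i => X i ω) t n)) atTop (𝓝 t) :=
    tendsto_empCDF_sampleQuantile (x := fun i => X i ω) h2
  exact tendsto_mean_sq_score (x := fun i => X i ω) h1 h3 h6 h4 h5

/-- The scaled transformed adjusted empirical log-likelihood ratio converges in distribution to the
square of a standard normal variable. -/
theorem tendstoInDistribution_tael [IsProbabilityMeasure P] [IsProbabilityMeasure ν]
    (hlaw : ∀ i, HasLaw (X i) ν P) (hindep : iIndepFun X P)
    (hsq : MemLp (fun x : ℝ => x) 2 ν) (ht0 : 0 < t) (ht1 : t < 1)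
    (hcont : ∀ᶠ x in 𝓝 (popQuantile ν t), ContinuousAt (fun y => cdf ν y) x)
    (huniq : ∀ x, popQuantile ν t < x → t < cdf ν x) :
    TendstoInDistribution
      (fun (n : ℕ) ω => sigmaPSq ν t / sigmaVSq ν t *
        tael (fun i : Fin n => X i ω) t (lorenz ν t))
      atTop (fun z => z ^ 2) (fun _ => P) (gaussianReal 0 1) := by
  have hψ := cdf_popQuantile ht0 hcont.self_of_nhds huniq
  have hp := sigmaPSq_pos hsq ht0 ht1 hcont.self_of_nhds hψ
  have hv := sigmaVSq_pos hsq ht0 ht1 hcont.self_of_nhds hψ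
  have hT := tendstoInDistribution_score hlaw hindep hsq ht0 ht1.le hcont huniq
  have hsqT := hT.continuous_comp (g := fun z => z ^ 2 / sigmaVSq ν t) (by fun_prop)
  have hlim : (fun z : ℝ => z ^ 2 / sigmaVSq ν t) ∘ (fun z => √(sigmaVSq ν t) * z) =
      fun z => z ^ 2 := by
    ext z
    simp only [Function.comp, mul_pow, Real.sq_sqrt hv.le]
    exact mul_div_cancel_left₀ _ hv.ne'
  rw [hlim] at hsqT
  have hmeas : ∀ n : ℕ, AEMeasurable (fun ω => sigmaPSq ν t / sigmaVSq ν t *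
      tael (fun i : Fin n => X i ω) t (lorenz ν t)) P := fun n =>
    aemeasurable_comp_sample hlaw ((measurable_tael ht0 ht1.le (lorenz ν t)).const_mul _)
  refine tendstoInDistribution_of_tendstoInMeasure_sub _ _ hsqT ?_ hmeas
  -- Here tightness comes from the normalized score sum itself.
  refine tendstoInMeasure_zero_of_tight hT
    (fun n => (hmeas n).sub (hsqT.forall_aemeasurable n)) ?_
  filter_upwards [ae_tendsto_mean_sq_score hlaw hindep hsq ht0 ht1.le hcont huniq,
    ae_tendsto_sq_div hlaw hindep hsq] with ω h1 h2 M
  have h3 := (tendsto_transformed_adjusted hp h1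
    (fun z hz => eventually_abs_score_le h2 hz) M).const_mul (sigmaPSq ν t / sigmaVSq ν t)
  rw [mul_zero] at h3
  refine h3.congr fun n => ?_
  simp only [Pi.sub_apply, Function.comp, tael, ael, adjScore]
  field_simp

end Main

end Lorenz

theorem theorem2p4 {Ω : Type*} [MeasurableSpace Ω] (P : Measure Ω) [IsProbabilityMeasure P]
    (ν : Measure ℝ) [IsProbabilityMeasure ν]
    (X : ℕ → Ω → ℝ)
    (hlaw : ∀ i, HasLaw (X i) ν P)
    (hindep : iIndepFun X P)
    (hsq : MemLp (fun x : ℝ => x) 2 ν)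
    (t₀ : ℝ) (ht₀ : t₀ ∈ Set.Ioo (0 : ℝ) 1)
    (hcont : ∀ᶠ x in 𝓝 (Lorenz.popQuantile ν t₀), ContinuousAt (fun y => cdf ν y) x)
    (huniq : ∀ x, Lorenz.popQuantile ν t₀ < x → t₀ < cdf ν x) :
    (∀ (n : ℕ) (ω : Ω),
      (∃ lam : ℝ, Lorenz.IsMultiplier
        (Lorenz.adjScore (fun i : Fin n => X i ω) t₀ (Lorenz.lorenz ν t₀)) lam) ∧
      ∀ lam : ℝ, Lorenz.IsMultiplier
          (Lorenz.adjScore (fun i : Fin n => X i ω) t₀ (Lorenz.lorenz ν t₀)) lam →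
        Lorenz.ael (fun i : Fin n => X i ω) t₀ (Lorenz.lorenz ν t₀) =
          2 * ∑ i, Real.log (1 + lam *
            Lorenz.adjScore (fun i : Fin n => X i ω) t₀ (Lorenz.lorenz ν t₀) i)) ∧
    0 < Lorenz.sigmaPSq ν t₀ ∧ 0 < Lorenz.sigmaVSq ν t₀ ∧
    TendstoInDistribution
      (fun (n : ℕ) (ω : Ω) => Lorenz.sigmaPSq ν t₀ / Lorenz.sigmaVSq ν t₀ *
        Lorenz.tael (fun i : Fin n => X i ω) t₀ (Lorenz.lorenz ν t₀))
      atTop (fun y : ℝ => y) (fun _ => P) Lorenz.chiSqOne := by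
  have hψ := Lorenz.cdf_popQuantile ht₀.1 hcont.self_of_nhds huniq
  refine ⟨fun n ω => ⟨Lorenz.exists_isMultiplier_adjoinPseudo _, fun lam hlam =>
      hlam.empLogLikRatio_eq (Nat.succ_ne_zero n)⟩,
    Lorenz.sigmaPSq_pos hsq ht₀.1 ht₀.2 hcont.self_of_nhds hψ,
    Lorenz.sigmaVSq_pos hsq ht₀.1 ht₀.2 hcont.self_of_nhds hψ, ?_⟩
  have h := Lorenz.tendstoInDistribution_tael hlaw hindep hsq ht₀.1 ht₀.2 hcont huniq
  refine ⟨h.forall_aemeasurable, aemeasurable_id', ?_⟩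
  -- Convergence in distribution sees only the law of the limit, so `z ^ 2` under the Gaussian may
  -- be replaced by the identity under `chiSqOne`.
  have hlaw2 : (gaussianReal 0 1).map (fun z : ℝ => z ^ 2) =
      Lorenz.chiSqOne.map (fun y => y) := Measure.map_id'.symm
  have h2 := h.tendsto
  simp only [hlaw2] at h2
  exact h2
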